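/- Let $T=\mathbb{R}^2/\mathbb{Z}^2$ be the unit square with wraparound (the flat torus), and let $r=r(n)>0$ with $r(n)\to 0$ as $n\to\infty$. Let $G(n,r)$ be the random geometric graph whose vertices are $n$ independent, uniformly distributed points of $T$, in which two points are joined by a straight-line edge (a shortest segment on $T$) if and only if their Euclidean distance on $T$ is at most $r$. An edge is called free if its interior (the edge without its endpoints) is not intersected by any other edge of the graph. "W.h.p." means with probability tending to $1$ as $n\to\infty$, and $f\ll g$ means $f=o(g)$ as $n\to\infty$. Then: 1. If $r\ll \frac1n$, then w.h.p. $G(n,r)$ has no edge. 2. If $\frac1n\ll r\ll \frac1{n^{2/3}}$, then w.h.p. $G(n,r)$ has an edge and every edge of $G(n,r)$ is free. 3. For every constant $\epsilon>0$: if $\frac1{n^{2/3}}\ll r\ll\frac1{n^{1/2+\epsilon}}$, then w.h.p. $G(n,r)$ has a free edge. 4. If $r\gg\frac{(\ln n)^{3/4}}{n^{1/4}}$, then w.h.p. $G(n,r)$ has no free edge. -/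

import Mathlib

open MeasureTheory Filter Topology Asymptotics

namespace TorusRGG

/-- The flat torus `ℝ² / ℤ²`, i.e. the unit square with wraparound. Its `volume` is the product of
the normalised Haar measures of the two circles, i.e. the uniform distribution. -/
abbrev Torus : Type := UnitAddTorus (Fin 2)

/-- The Euclidean plane, the universal cover of the torus. -/
abbrev Plane : Type := EuclideanSpace ℝ (Fin 2)

/-- The covering map from the plane to the torus, reducing both coordinates modulo `1`. -/
def proj (P : Plane) : Torus := fun i => ((P i : ℝ) : UnitAddCircle)

/-- The Euclidean distance on the torus. The norm on `UnitAddCircle` is the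
distance of a real representative to the nearest integer. -/
noncomputable def flatDist (x y : Torus) : ℝ :=
  Real.sqrt (∑ i, ‖x i - y i‖ ^ 2)

/-- `P` and `Q` are points of the plane lying over `x` and `y`, at distance equal to the distance
of `x` and `y` on the torus: the segment `PQ` projects to a shortest segment joining `x` and `y`.
(Such a pair is unique up to a common lattice translation unless a coordinate
difference is exactly `1/2` modulo `1`.) -/
def IsShortestLift (x y : Torus) (P Q : Plane) : Prop :=
  proj P = x ∧ proj Q = y ∧ dist P Q = flatDist x y

/-- The points of the torus on the (closed) straight-line edge joining `x` and `y`. -/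
def edgePoints (x y : Torus) : Set Torus :=
  {z | ∃ P Q : Plane, IsShortestLift x y P Q ∧ z ∈ proj '' segment ℝ P Q}

/-- The points of the torus in the interior of the straight-line edge joining `x` and `y`
(the edge without its two endpoints). -/
def edgeInterior (x y : Torus) : Set Torus :=
  {z | ∃ P Q : Plane, IsShortestLift x y P Q ∧ z ∈ proj '' openSegment ℝ P Q}

/-- The geometric graph on the points `X 0, …, X (n - 1)`: two of them are joined by an edge if and
only if their distance on the torus is at most `ρ`. -/
def diskGraph {n : ℕ} (X : Fin n → Torus) (ρ : ℝ) : SimpleGraph (Fin n) where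
  Adj i j := i ≠ j ∧ flatDist (X i) (X j) ≤ ρ
  symm := ⟨fun i j h => ⟨h.1.symm, by
    have hs : flatDist (X j) (X i) = flatDist (X i) (X j) := by
      simp only [flatDist, norm_sub_rev]
    exact hs.trans_le h.2⟩⟩
  loopless := ⟨fun _ h => h.1 rfl⟩

/-- `ij` is an edge of the graph and no other edge meets its interior. -/
def IsFreeEdge {n : ℕ} (X : Fin n → Torus) (ρ : ℝ) (i j : Fin n) : Prop :=
  (diskGraph X ρ).Adj i j ∧
    ∀ k l : Fin n, (diskGraph X ρ).Adj k l → s(k, l) ≠ s(i, j) →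
      Disjoint (edgeInterior (X i) (X j)) (edgePoints (X k) (X l))

/-- The joint law of `n` independent, uniformly distributed points of the torus. -/
noncomputable def uniformPoints (n : ℕ) : Measure (Fin n → Torus) :=
  Measure.pi fun _ => (volume : Measure Torus)

/-- With high probability: the probability of the event `E n` for `n` independent uniform points
of the torus tends to `1` as `n → ∞`. -/
def WHP (E : ∀ n : ℕ, (Fin n → Torus) → Prop) : Prop :=
  Tendsto (fun n => uniformPoints n {X | E n X}) atTop (𝓝 1)

end TorusRGG

namespace TorusRGG

/-! ### High probability through upper bounds for the bad event -/

/-! Every claim is a union bound over small tuples of vertices, and the probability of each tuple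
comes from `uniformPoints_confined_le`: given the points outside `J`, those in `J` are independent
and uniform, so they all fall in a region of area at most `c` determined by the others with
probability at most `c ^ |J|`.

Sparse regimes. The expected number of edges is O(n²r²), which settles claim 1. An edge appears
among 2m points once mr → ∞: if the first m have no edge, disjoint squares around them cover area of
order mr², and the other m points must all avoid them (`uniformPoints_no_edge_le`). A non-free edge
brings in, almost surely, four distinct points within O(r), and there are O(n⁴r⁶) such quadruples in
expectation; this gives claim 2. Under claim 3 that count is no longer small, so only the first 2m
points are searched, with m just above 1/r: they still span an edge, but when nr² → 0 no third point
of the whole sample comes near any such edge.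

Dense regime. Edges shorter than ℓ ≪ 1/n do not occur. Beside a longer edge lie L disjoint sectors,
each of which w.h.p. contains a point of one half of the sample. Each such point casts through the
edge a "shadow" of width ℓ on the other side; shadows from different sectors are disjoint, so
together they have area of order Lℓr, and a point of the other half falling in one of them yields a
crossing edge (`edges_cross`, `disjoint_cell`). The failure probabilities are exponentially small in
a power of n, which absorbs the union over n² pairs. -/

instance isProbabilityMeasure_circle : IsProbabilityMeasure (volume : Measure UnitAddCircle) :=
  ⟨UnitAddCircle.measure_univ⟩

instance isProbabilityMeasure_torus : IsProbabilityMeasure (volume : Measure Torus) := by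
  rw [volume_pi]; infer_instance

instance isProbabilityMeasure_uniformPoints (n : ℕ) : IsProbabilityMeasure (uniformPoints n) := by
  unfold uniformPoints; infer_instance

/-- Only subadditivity of the outer measure is used, so no event needs to be shown measurable. -/
theorem WHP_of_bad {E : ∀ n : ℕ, (Fin n → Torus) → Prop} {b : ℕ → ℝ}
    (hb : Tendsto b atTop (𝓝 0))
    (h : ∀ᶠ n in atTop, uniformPoints n {X | ¬ E n X} ≤ ENNReal.ofReal (b n)) : WHP E := by
  have hb' : Tendsto (fun n => 1 - ENNReal.ofReal (b n)) atTop (𝓝 1) := by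
    have := ENNReal.Tendsto.sub (tendsto_const_nhds (x := (1 : ENNReal)))
      (ENNReal.tendsto_ofReal hb) (Or.inl ENNReal.one_ne_top)
    simpa using this
  refine tendsto_of_tendsto_of_tendsto_of_le_of_le' hb' tendsto_const_nhds ?_ ?_
  · filter_upwards [h] with n hn
    have h1 : (1 : ENNReal) ≤ uniformPoints n {X | E n X} + uniformPoints n {X | ¬ E n X} := by
      rw [← measure_univ (μ := uniformPoints n)]
      refine (measure_mono ?_).trans (measure_union_le _ _)
      intro X _
      exact Classical.em (E n X)
    rw [tsub_le_iff_right]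
    exact h1.trans (add_le_add_right hn _)
  · exact Eventually.of_forall fun n => prob_le_one

/-! ### Independence: points confined to a random set depending on the other points -/

theorem uniformPoints_confined_le {n : ℕ} (J : Finset (Fin n)) (G : (Fin n → Torus) → Prop)
    (C : (Fin n → Torus) → Torus → Prop)
    (hG : MeasurableSet {X | G X}) (hC : MeasurableSet {p : (Fin n → Torus) × Torus | C p.1 p.2})
    (hGJ : ∀ X Y, (∀ i ∉ J, X i = Y i) → G X → G Y)
    (hCJ : ∀ X Y, (∀ i ∉ J, X i = Y i) → ∀ z, C X z → C Y z)
    {c : ENNReal} (hc : ∀ X, G X → volume {z | C X z} ≤ c) :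
    uniformPoints n {X | G X ∧ ∀ l ∈ J, C X (X l)} ≤ c ^ J.card := by
  classical
  set E : Set (Fin n → Torus) := {X | G X ∧ ∀ l ∈ J, C X (X l)} with hE
  have hEm : MeasurableSet E := by
    have : E = {X | G X} ∩ ⋂ l ∈ J, {X | C X (X l)} := by
      ext X; simp [hE]
    rw [this]
    refine hG.inter (Finset.measurableSet_biInter _ fun l _ => ?_)
    exact (measurable_id.prodMk (measurable_pi_apply l)) hC
  have hone : ∫⁻ _ : Fin n → Torus, c ^ J.card ∂uniformPoints n = c ^ J.card := by simp
  rw [← lintegral_indicator_one hEm, ← hone]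
  unfold uniformPoints
  -- Fubini: integrate over the coordinates in `J` first, the others being frozen at `X`.
  refine lintegral_le_of_lmarginal_le J (measurable_one.indicator hEm) measurable_const ?_
  intro X
  unfold lmarginal
  have hupd : ∀ y : (∀ i : J, Torus), ∀ i ∉ J, Function.updateFinset X J y i = X i := by
    intro y i hi
    simp [Function.updateFinset, hi]
  have hconst : ∫⁻ _ : (∀ i : J, Torus), c ^ J.card ∂Measure.pi (fun _ : J => (volume : Measure Torus))
      = c ^ J.card := by rw [lintegral_const, measure_univ, mul_one]
  rw [hconst]
  by_cases hGX : G X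
  · have hsub : ∀ y : (∀ i : J, Torus), E.indicator (1 : (Fin n → Torus) → ENNReal)
        (Function.updateFinset X J y) ≤
        (Set.univ.pi fun _ : J => {z | C X z}).indicator 1 y := by
      intro y
      by_cases hy : Function.updateFinset X J y ∈ E
      · have : y ∈ Set.univ.pi fun _ : J => {z | C X z} := by
          rintro ⟨l, hl⟩ -
          have h1 := hCJ _ X (hupd y) _ (hy.2 l hl)
          simpa [Function.updateFinset, hl] using h1
        simp [hy, this]
      · simp [hy]
    refine (lintegral_mono hsub).trans ((lintegral_indicator_one_le _).trans ?_)
    rw [Measure.pi_pi, Finset.prod_const, Finset.card_univ, Fintype.card_coe]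
    exact pow_le_pow_left' (hc X hGX) _
  · have hz : ∀ y : (∀ i : J, Torus), E.indicator (1 : (Fin n → Torus) → ENNReal)
        (Function.updateFinset X J y) = 0 := by
      intro y
      refine Set.indicator_of_notMem (fun hy => hGX ?_) _
      exact hGJ _ X (hupd y) hy.1
    simp [hz]

/-- The union bound over a finite family of bad events. -/
theorem uniformPoints_exists_le {n : ℕ} {ι : Type*} (s : Finset ι)
    (B : ι → (Fin n → Torus) → Prop) {c : ℝ}
    (h : ∀ i ∈ s, uniformPoints n {X | B i X} ≤ ENNReal.ofReal c) :
    uniformPoints n {X | ∃ i ∈ s, B i X} ≤ ENNReal.ofReal (s.card * c) := by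
  have : {X | ∃ i ∈ s, B i X} = ⋃ i ∈ s, {X | B i X} := by ext X; simp
  rw [this]
  refine (measure_biUnion_finset_le _ _).trans ((Finset.sum_le_sum h).trans ?_)
  rw [ENNReal.ofReal_mul (Nat.cast_nonneg _)]
  simp

theorem uniformPoints_or_le {n : ℕ} {A B C : (Fin n → Torus) → Prop} {a b : ℝ} (ha0 : 0 ≤ a)
    (hb0 : 0 ≤ b) (hA : uniformPoints n {X | A X} ≤ ENNReal.ofReal a)
    (hB : uniformPoints n {X | B X} ≤ ENNReal.ofReal b) (hC : ∀ X, C X → A X ∨ B X) :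
    uniformPoints n {X | C X} ≤ ENNReal.ofReal (a + b) := by
  rw [ENNReal.ofReal_add ha0 hb0]
  refine (measure_mono ?_).trans ((measure_union_le _ _).trans (add_le_add hA hB))
  exact hC

theorem volume_compl_le_exp {S : Set Torus} (hS : MeasurableSet S) {p : ℝ}
    (hp : ENNReal.ofReal p ≤ volume S) : volume Sᶜ ≤ ENNReal.ofReal (Real.exp (-p)) := by
  rw [prob_compl_eq_one_sub hS]
  refine (tsub_le_tsub_left hp 1).trans (tsub_le_iff_right.2 ?_)
  rw [← ENNReal.ofReal_one]
  refine (ENNReal.ofReal_le_ofReal ?_).trans ENNReal.ofReal_add_le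
  linarith [Real.one_sub_le_exp_neg p]

/-! ### Charts of the torus -/

/-- The representative in `(-1/2, 1/2]` of a point of the circle. -/
noncomputable def rep (a : UnitAddCircle) : ℝ := (AddCircle.measurableEquivIoc 1 (-1/2) a : ℝ)

theorem measurable_rep : Measurable rep :=
  measurable_subtype_coe.comp (AddCircle.measurableEquivIoc 1 (-1/2)).measurable

theorem rep_mem (a : UnitAddCircle) : rep a ∈ Set.Ioc (-1/2 : ℝ) (-1/2 + 1) :=
  (AddCircle.measurableEquivIoc 1 (-1/2) a).2

theorem coe_rep (a : UnitAddCircle) : ((rep a : ℝ) : UnitAddCircle) = a :=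
  (AddCircle.equivIoc 1 (-1/2)).symm_apply_apply a

theorem norm_coe_eq_abs {t : ℝ} (h : |t| ≤ 1 / 2) : ‖(t : UnitAddCircle)‖ = |t| :=
  (AddCircle.norm_coe_eq_abs_iff 1 one_ne_zero).2 (by simpa using h)

theorem norm_coe_le_abs (t : ℝ) : ‖(t : UnitAddCircle)‖ ≤ |t| := by
  rw [UnitAddCircle.norm_eq]
  simpa using round_le t 0

theorem abs_rep (a : UnitAddCircle) : |rep a| = ‖a‖ := by
  have h := rep_mem a
  rw [← norm_coe_eq_abs (t := rep a), coe_rep]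
  rw [abs_le]; constructor <;> linarith [h.1, h.2]

theorem measurePreserving_rep :
    MeasurePreserving rep volume (volume.restrict (Set.Ioc (-1/2 : ℝ) (-1/2 + 1))) := by
  have h := AddCircle.measurePreserving_equivIoc 1 (a := -1/2)
  have h2 : MeasurePreserving (Subtype.val : Set.Ioc (-1/2 : ℝ) (-1/2 + 1) → ℝ)
      (Measure.comap Subtype.val volume) (volume.restrict (Set.Ioc (-1/2 : ℝ) (-1/2 + 1))) :=
    ⟨measurable_subtype_coe, map_comap_subtype_coe measurableSet_Ioc _⟩
  exact h2.comp h

/-- The displacement from `x` to `z`, both coordinates in `(-1/2, 1/2]`. -/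
noncomputable def disp (x z : Torus) : ℝ × ℝ := (rep (z 0 - x 0), rep (z 1 - x 1))

theorem measurePreserving_disp (x : Torus) :
    MeasurePreserving (disp x) volume (volume.restrict
      (Set.Ioc (-1/2 : ℝ) (-1/2 + 1) ×ˢ Set.Ioc (-1/2 : ℝ) (-1/2 + 1))) := by
  have h1 : MeasurePreserving (fun z : Torus => z - x) volume volume := by
    have := measurePreserving_pi (fun _ : Fin 2 => (volume : Measure UnitAddCircle)) (fun _ => volume)
      (fun i => measurePreserving_sub_right (volume : Measure UnitAddCircle) (x i))
    exact this
  have h2 := volume_preserving_finTwoArrow UnitAddCircle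
  have h3 := measurePreserving_rep.prod measurePreserving_rep
  have h4 := h3.comp (h2.comp h1)
  rw [Measure.prod_restrict] at h4
  exact h4

/-- The coordinates of the displacement from `x` to `z` in the orthonormal frame whose first
vector is `u`. -/
noncomputable def chart (u : ℝ × ℝ) (x z : Torus) : ℝ × ℝ :=
  (u.1 * (disp x z).1 + u.2 * (disp x z).2, -u.2 * (disp x z).1 + u.1 * (disp x z).2)

theorem volume_rotate_preimage {u : ℝ × ℝ} (hu : u.1 ^ 2 + u.2 ^ 2 = 1) (D : Set (ℝ × ℝ)) :
    volume ((fun w : ℝ × ℝ => (u.1 * w.1 + u.2 * w.2, -u.2 * w.1 + u.1 * w.2)) ⁻¹' D)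
      = volume D := by
  set f : ℝ × ℝ →ₗ[ℝ] ℝ × ℝ := Matrix.toLin (Module.Basis.finTwoProd ℝ) (Module.Basis.finTwoProd ℝ)
    !![u.1, u.2; -u.2, u.1] with hf
  have hdet : LinearMap.det f = 1 := by
    rw [hf, LinearMap.det_toLin, Matrix.det_fin_two_of]; linarith
  have hfun : (fun w : ℝ × ℝ => (u.1 * w.1 + u.2 * w.2, -u.2 * w.1 + u.1 * w.2)) = f := by
    ext w <;> simp [hf, Matrix.toLin_finTwoProd_apply]
  rw [hfun, Measure.addHaar_preimage_linearMap volume (by rw [hdet]; norm_num)]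
  simp [hdet]

theorem volume_chart_preimage_le {u : ℝ × ℝ} (hu : u.1 ^ 2 + u.2 ^ 2 = 1) (x : Torus)
    {D : Set (ℝ × ℝ)} (hD : MeasurableSet D) :
    volume {z | chart u x z ∈ D} ≤ volume D := by
  rw [← volume_rotate_preimage hu D]
  set D' := (fun w : ℝ × ℝ => (u.1 * w.1 + u.2 * w.2, -u.2 * w.1 + u.1 * w.2)) ⁻¹' D with hD'
  have hm : MeasurableSet D' := by
    refine MeasurableSet.preimage hD ?_
    fun_prop
  have := (measurePreserving_disp x).measure_preimage hm.nullMeasurableSet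
  calc volume {z | chart u x z ∈ D} = _ := this
    _ ≤ _ := Measure.restrict_apply_le _ _

/-- The open disc of radius 1/2 is invariant under rotation and lies inside the fundamental square,
so no part of `D` is lost when it is wrapped onto the torus. -/
theorem volume_chart_preimage {u : ℝ × ℝ} (hu : u.1 ^ 2 + u.2 ^ 2 = 1) (x : Torus)
    {D : Set (ℝ × ℝ)} (hD : MeasurableSet D) (hsmall : ∀ p ∈ D, p.1 ^ 2 + p.2 ^ 2 < 1 / 4) :
    volume {z | chart u x z ∈ D} = volume D := by
  rw [← volume_rotate_preimage hu D]
  set D' := (fun w : ℝ × ℝ => (u.1 * w.1 + u.2 * w.2, -u.2 * w.1 + u.1 * w.2)) ⁻¹' D with hD'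
  have hm : MeasurableSet D' := by
    refine MeasurableSet.preimage hD ?_
    fun_prop
  have := (measurePreserving_disp x).measure_preimage hm.nullMeasurableSet
  have hsub : D' ⊆ Set.Ioc (-1/2 : ℝ) (-1/2 + 1) ×ˢ Set.Ioc (-1/2 : ℝ) (-1/2 + 1) := by
    intro w hw
    have h1 := hsmall _ hw
    have h2 : w.1 ^ 2 + w.2 ^ 2 < (1 / 2) ^ 2 := by
      have : (u.1 * w.1 + u.2 * w.2) ^ 2 + (-u.2 * w.1 + u.1 * w.2) ^ 2
          = (u.1 ^ 2 + u.2 ^ 2) * (w.1 ^ 2 + w.2 ^ 2) := by ring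
      simp only at h1
      rw [this, hu] at h1
      linarith
    have h3 := abs_lt_of_sq_lt_sq (show w.1 ^ 2 < (1 / 2) ^ 2 by nlinarith [sq_nonneg w.2]) (by norm_num)
    have h4 := abs_lt_of_sq_lt_sq (show w.2 ^ 2 < (1 / 2) ^ 2 by nlinarith [sq_nonneg w.1]) (by norm_num)
    rw [abs_lt] at h3 h4
    refine ⟨⟨?_, ?_⟩, ⟨?_, ?_⟩⟩ <;> linarith [h3.1, h3.2, h4.1, h4.2]
  calc volume {z | chart u x z ∈ D} = _ := this
    _ = _ := by rw [Measure.restrict_apply hm, Set.inter_eq_left.2 hsub]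

theorem _root_.Measurable.torusDisp {α : Type*} [MeasurableSpace α] {f g : α → Torus}
    (hf : Measurable f) (hg : Measurable g) : Measurable fun a => disp (f a) (g a) := by
  unfold disp
  refine Measurable.prodMk ?_ ?_ <;> refine measurable_rep.comp ?_ <;> fun_prop

/-- The product neighbourhood of `x` of radius `ρ`. -/
def near (ρ : ℝ) (x z : Torus) : Prop := ∀ i, ‖z i - x i‖ ≤ ρ

theorem near_symm {ρ : ℝ} {x z : Torus} (h : near ρ x z) : near ρ z x := fun i => by
  rw [norm_sub_rev]; exact h i

theorem near_trans {ρ σ : ℝ} {x y z : Torus} (h : near ρ x y) (h' : near σ y z) :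
    near (ρ + σ) x z := fun i => by
  have := norm_add_le (z i - y i) (y i - x i)
  rw [sub_add_sub_cancel] at this
  linarith [h i, h' i]

theorem near_mono {ρ σ : ℝ} (h : ρ ≤ σ) {x z : Torus} (hz : near ρ x z) : near σ x z :=
  fun i => (hz i).trans h

theorem measurableSet_near (ρ : ℝ) : MeasurableSet {p : Torus × Torus | near ρ p.1 p.2} := by
  have : {p : Torus × Torus | near ρ p.1 p.2} = ⋂ i, {p | ‖p.2 i - p.1 i‖ ≤ ρ} := by
    ext p; simp [near]
  rw [this]
  refine MeasurableSet.iInter fun i => measurableSet_le ?_ measurable_const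
  fun_prop

theorem volume_near (ρ : ℝ) (x : Torus) :
    volume {z | near ρ x z} = ENNReal.ofReal (min 1 (2 * ρ)) ^ 2 := by
  have : {z | near ρ x z} = Set.univ.pi fun i => Metric.closedBall (x i) ρ := by
    ext z; simp [near, dist_eq_norm]
  rw [this, volume_pi, Measure.pi_pi]
  simp [AddCircle.volume_closedBall]

theorem volume_near_le {ρ : ℝ} (hρ : 0 ≤ ρ) (x : Torus) :
    volume {z | near ρ x z} ≤ ENNReal.ofReal (4 * ρ ^ 2) := by
  rw [volume_near, show 4 * ρ ^ 2 = (2 * ρ) ^ 2 by ring, ENNReal.ofReal_pow (by linarith)]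
  gcongr
  exact min_le_right _ _

theorem near_of_flatDist_le {ρ : ℝ} {x z : Torus} (h : flatDist x z ≤ ρ) : near ρ x z := by
  intro i
  have h1 : ‖x i - z i‖ ≤ flatDist x z := by
    refine Real.le_sqrt_of_sq_le ?_
    exact Finset.single_le_sum (f := fun i => ‖x i - z i‖ ^ 2) (fun _ _ => sq_nonneg _)
      (Finset.mem_univ i)
  rw [norm_sub_rev]; linarith

theorem flatDist_le_of_near {ρ : ℝ} (hρ : 0 ≤ ρ) {x z : Torus} (h : near ρ x z) :
    flatDist x z ≤ 2 * ρ := by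
  refine Real.sqrt_le_iff.2 ⟨by linarith, ?_⟩
  rw [Fin.sum_univ_two]
  have h0 := h 0
  have h1 := h 1
  rw [norm_sub_rev] at h0 h1
  nlinarith [norm_nonneg (x 0 - z 0), norm_nonneg (x 1 - z 1)]

theorem flatDist_comm (x y : Torus) : flatDist x y = flatDist y x := by
  simp only [flatDist, norm_sub_rev]

theorem flatDist_eq_disp (x y : Torus) :
    flatDist x y = Real.sqrt ((disp x y).1 ^ 2 + (disp x y).2 ^ 2) := by
  unfold flatDist disp
  rw [Fin.sum_univ_two, ← sq_abs (rep _), ← sq_abs (rep (y 1 - x 1)), abs_rep, abs_rep,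
    norm_sub_rev, norm_sub_rev (x 1)]

/-! ### Shortest lifts and edges -/

theorem rep_coe {t : ℝ} (h : |t| < 1 / 2) : rep (t : UnitAddCircle) = t := by
  rw [abs_lt] at h
  have : t ∈ Set.Ioc (-1/2 : ℝ) (-1/2 + 1) := ⟨by linarith [h.1], by linarith [h.2]⟩
  exact congrArg Subtype.val (AddCircle.equivIoc_coe_eq (p := (1 : ℝ)) this)

theorem eq_of_coe_eq {s t : ℝ} (hs : |s| < 1 / 2) (ht : |t| < 1 / 2)
    (h : (s : UnitAddCircle) = (t : UnitAddCircle)) : s = t := by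
  rw [← rep_coe hs, ← rep_coe ht, h]

theorem dist_plane (P Q : Plane) : dist P Q = Real.sqrt ((P 0 - Q 0) ^ 2 + (P 1 - Q 1) ^ 2) := by
  rw [EuclideanSpace.dist_eq, Fin.sum_univ_two, Real.dist_eq, Real.dist_eq, sq_abs, sq_abs]

theorem abs_sub_le_dist (P Q : Plane) (i : Fin 2) : |P i - Q i| ≤ dist P Q := by
  rw [dist_plane]
  refine Real.abs_le_sqrt ?_
  fin_cases i <;> simp <;> positivity

theorem flatDist_proj {P Q : Plane} (h : dist P Q ≤ 1 / 2) :
    flatDist (proj P) (proj Q) = dist P Q := by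
  have h' : ∀ i, ‖proj P i - proj Q i‖ = |P i - Q i| := fun i => by
    unfold proj
    rw [← AddCircle.coe_sub]
    exact norm_coe_eq_abs ((abs_sub_le_dist P Q i).trans h)
  unfold flatDist
  rw [Fin.sum_univ_two, h', h', sq_abs, sq_abs, dist_plane]

theorem isShortestLift_comm {x y : Torus} {P Q : Plane} (h : IsShortestLift x y P Q) :
    IsShortestLift y x Q P :=
  ⟨h.2.1, h.1, by rw [dist_comm, h.2.2, flatDist_comm]⟩

theorem edgePoints_comm (x y : Torus) : edgePoints x y = edgePoints y x := by
  have key : ∀ x y : Torus, edgePoints x y ⊆ edgePoints y x := by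
    rintro x y z ⟨P, Q, h, hz⟩
    exact ⟨Q, P, isShortestLift_comm h, by rwa [segment_symm]⟩
  exact (key x y).antisymm (key y x)

theorem edgeInterior_comm (x y : Torus) : edgeInterior x y = edgeInterior y x := by
  have key : ∀ x y : Torus, edgeInterior x y ⊆ edgeInterior y x := by
    rintro x y z ⟨P, Q, h, hz⟩
    exact ⟨Q, P, isShortestLift_comm h, by rwa [openSegment_symm]⟩
  exact (key x y).antisymm (key y x)

theorem edgeInterior_subset_edgePoints (x y : Torus) : edgeInterior x y ⊆ edgePoints x y := by
  rintro z ⟨P, Q, h, hz⟩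
  exact ⟨P, Q, h, Set.image_mono (openSegment_subset_segment ℝ P Q) hz⟩

/-- The projection of a convex combination of `P` and `Q`, relative to that of `P`. -/
theorem combo_sub_eq_coe {x z : Torus} {P Q : Plane} (hP : proj P = x) {θ : ℝ}
    (hz : proj ((1 - θ) • P + θ • Q) = z) (i : Fin 2) :
    z i - x i = ((θ * (Q i - P i) : ℝ) : UnitAddCircle) := by
  rw [← hz, ← hP]
  unfold proj
  rw [← AddCircle.coe_sub]
  congr 1
  simp
  ring

theorem near_of_mem_edgePoints {ρ : ℝ} {x y z : Torus} (h : flatDist x y ≤ ρ)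
    (hz : z ∈ edgePoints x y) : near ρ x z := by
  obtain ⟨P, Q, ⟨hP, hQ, hd⟩, w, hw, hwz⟩ := hz
  rw [segment_eq_image] at hw
  obtain ⟨θ, hθ, rfl⟩ := hw
  intro i
  rw [combo_sub_eq_coe hP hwz i]
  refine (norm_coe_le_abs _).trans ?_
  rw [abs_mul, abs_of_nonneg hθ.1]
  have h1 := abs_sub_le_dist Q P i
  rw [dist_comm, hd] at h1
  nlinarith [hθ.2, abs_nonneg (Q i - P i)]

/-- An edge that is not free has all endpoints of a crossing edge nearby. -/
theorem exists_near_of_not_isFreeEdge {n : ℕ} {X : Fin n → Torus} {ρ : ℝ} {i j : Fin n}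
    (hadj : (diskGraph X ρ).Adj i j) (hfree : ¬ IsFreeEdge X ρ i j) :
    ∃ k l, (diskGraph X ρ).Adj k l ∧ s(k, l) ≠ s(i, j) ∧
      near (2 * ρ) (X i) (X k) ∧ near (2 * ρ) (X i) (X l) ∧
      ∃ z, z ∈ edgeInterior (X i) (X j) ∧ z ∈ edgePoints (X k) (X l) := by
  unfold IsFreeEdge at hfree
  push Not at hfree
  obtain ⟨k, l, hkl, hne, hz⟩ := hfree hadj
  obtain ⟨z, hz1, hz2⟩ := Set.not_disjoint_iff.1 hz
  -- The crossing point is within `ρ` of `X i` and of both ends of the crossing edge, whence the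
  -- radius `2 * ρ`.
  have h1 := near_of_mem_edgePoints hadj.2 (edgeInterior_subset_edgePoints _ _ hz1)
  have h2 := near_of_mem_edgePoints hkl.2 hz2
  rw [edgePoints_comm] at hz2
  have h3 := near_of_mem_edgePoints (flatDist_comm (X k) (X l) ▸ hkl.2) hz2
  rw [edgePoints_comm] at hz2
  refine ⟨k, l, hkl, hne, ?_, ?_, z, hz1, hz2⟩
  · rw [two_mul]; exact near_trans h1 (near_symm h2)
  · rw [two_mul]; exact near_trans h1 (near_symm h3)

theorem disp_eq_of_isShortestLift {x y : Torus} {P Q : Plane} (h : IsShortestLift x y P Q)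
    (hs : flatDist x y < 1 / 2) : disp x y = (Q 0 - P 0, Q 1 - P 1) := by
  have key : ∀ i, rep (y i - x i) = Q i - P i := fun i => by
    rw [← h.1, ← h.2.1]
    unfold proj
    rw [← AddCircle.coe_sub]
    refine rep_coe (lt_of_le_of_lt (abs_sub_le_dist Q P i) ?_)
    rw [dist_comm, h.2.2]; exact hs
  unfold disp
  rw [key, key]

/-- Two short edges with a common endpoint and a further common point are collinear. -/
theorem collinear_of_edges_meet {x y z t : Torus} (hxy : flatDist x y < 1 / 2)
    (hxz : flatDist x z < 1 / 2) (h1 : t ∈ edgeInterior x y) (h2 : t ∈ edgePoints x z) :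
    (disp x y).1 * (disp x z).2 - (disp x y).2 * (disp x z).1 = 0 := by
  obtain ⟨P, Q, hPQ, w, hw, hwt⟩ := h1
  obtain ⟨P', R, hPR, w', hw', hwt'⟩ := h2
  rw [openSegment_eq_image] at hw
  rw [segment_eq_image] at hw'
  obtain ⟨θ, hθ, rfl⟩ := hw
  obtain ⟨τ, hτ, rfl⟩ := hw'
  rw [disp_eq_of_isShortestLift hPQ hxy, disp_eq_of_isShortestLift hPR hxz]
  -- The lifts `P` and `P'` of `x` may differ by a lattice vector; both displacements are shorter
  -- than 1/2, so their equality modulo 1 is an equality of reals.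
  have key : ∀ i, θ * (Q i - P i) = τ * (R i - P' i) := fun i => by
    refine eq_of_coe_eq ?_ ?_ ?_
    · have h := abs_sub_le_dist Q P i
      rw [dist_comm, hPQ.2.2] at h
      rw [abs_mul, abs_of_pos hθ.1]
      nlinarith [hθ.1, hθ.2, abs_nonneg (Q i - P i)]
    · have h := abs_sub_le_dist R P' i
      rw [dist_comm, hPR.2.2] at h
      rw [abs_mul, abs_of_nonneg hτ.1]
      nlinarith [hτ.1, hτ.2, abs_nonneg (R i - P' i)]
    · rw [← combo_sub_eq_coe hPQ.1 hwt i, ← combo_sub_eq_coe hPR.1 hwt' i]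
  have h0 := key 0
  have h1 := key 1
  -- Only `θ` is known to be nonzero, because `t` is interior to the first edge; `τ` may vanish.
  have : θ * ((Q 0 - P 0) * (R 1 - P' 1) - (Q 1 - P 1) * (R 0 - P' 0)) = 0 := by
    linear_combination (R 1 - P' 1) * h0 - (R 0 - P' 0) * h1
  rcases mul_eq_zero.1 this with h | h
  · exact absurd h hθ.1.ne'
  · exact h

/-! ### Crossing edges in a rotated frame -/

/-- The unit vector in the direction of `v`. -/
noncomputable def unit (v : ℝ × ℝ) : ℝ × ℝ :=
  (v.1 / Real.sqrt (v.1 ^ 2 + v.2 ^ 2), v.2 / Real.sqrt (v.1 ^ 2 + v.2 ^ 2))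

theorem sq_add_sq_pos {v : ℝ × ℝ} (hv : v ≠ 0) : 0 < v.1 ^ 2 + v.2 ^ 2 := by
  by_contra h
  have h1 : v.1 = 0 := by nlinarith [sq_nonneg v.1, sq_nonneg v.2]
  have h2 : v.2 = 0 := by nlinarith [sq_nonneg v.1, sq_nonneg v.2]
  exact hv (Prod.ext h1 h2)

theorem unit_sq {v : ℝ × ℝ} (hv : v ≠ 0) : (unit v).1 ^ 2 + (unit v).2 ^ 2 = 1 := by
  have h := sq_add_sq_pos hv
  unfold unit
  simp only [div_pow, Real.sq_sqrt h.le]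
  rw [← add_div, div_self h.ne']

theorem measurable_unit : Measurable unit := by
  unfold unit
  fun_prop

/-- The point of the plane with coordinates `p` in the frame `u` at the lift of `x`. -/
noncomputable def framePoint (u : ℝ × ℝ) (x : Torus) (p : ℝ × ℝ) : Plane :=
  !₂[rep (x 0) + u.1 * p.1 - u.2 * p.2, rep (x 1) + u.2 * p.1 + u.1 * p.2]

/-- The frame is orthogonal, so its transpose inverts the rotation; pictures drawn in the chart can
therefore be lifted to the plane. -/
theorem proj_framePoint_chart {u : ℝ × ℝ} (hu : u.1 ^ 2 + u.2 ^ 2 = 1) (x z : Torus) :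
    proj (framePoint u x (chart u x z)) = z := by
  funext i
  unfold proj framePoint chart
  have h0 : u.1 * (u.1 * (disp x z).1 + u.2 * (disp x z).2)
      - u.2 * (-u.2 * (disp x z).1 + u.1 * (disp x z).2) = (disp x z).1 := by
    linear_combination (disp x z).1 * hu
  have h1 : u.2 * (u.1 * (disp x z).1 + u.2 * (disp x z).2)
      + u.1 * (-u.2 * (disp x z).1 + u.1 * (disp x z).2) = (disp x z).2 := by
    linear_combination (disp x z).2 * hu
  fin_cases i
  · simp only [Fin.zero_eta, Matrix.cons_val_zero]
    rw [add_sub_assoc, h0, AddCircle.coe_add, coe_rep, disp, coe_rep]; abel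
  · simp only [Fin.mk_one, Matrix.cons_val_one, Matrix.cons_val_fin_one]
    rw [add_assoc, h1, AddCircle.coe_add, coe_rep, disp, coe_rep]; abel

theorem proj_framePoint_zero (u : ℝ × ℝ) (x : Torus) : proj (framePoint u x 0) = x := by
  funext i
  unfold proj framePoint
  fin_cases i <;> simp [coe_rep]

theorem dist_framePoint {u : ℝ × ℝ} (hu : u.1 ^ 2 + u.2 ^ 2 = 1) (x : Torus) (p q : ℝ × ℝ) :
    dist (framePoint u x p) (framePoint u x q)
      = Real.sqrt ((p.1 - q.1) ^ 2 + (p.2 - q.2) ^ 2) := by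
  rw [dist_plane]
  congr 1
  simp only [framePoint, PiLp.toLp_apply, Matrix.cons_val_zero, Matrix.cons_val_one, Matrix.cons_val_fin_one]
  linear_combination ((p.1 - q.1) ^ 2 + (p.2 - q.2) ^ 2) * hu

theorem framePoint_combo (u : ℝ × ℝ) (x : Torus) (p q : ℝ × ℝ) (θ : ℝ) :
    (1 - θ) • framePoint u x p + θ • framePoint u x q
      = framePoint u x ((1 - θ) * p.1 + θ * q.1, (1 - θ) * p.2 + θ * q.2) := by
  ext i
  fin_cases i <;> simp [framePoint] <;> ring

/-- A sheared rectangle. -/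
def strip (c d σ w : ℝ) : Set (ℝ × ℝ) :=
  {p | p.2 ∈ Set.Ioo c d ∧ p.1 ∈ Set.Ioo (σ * p.2) (σ * p.2 + w)}

theorem chart_unit_disp {x y : Torus} (hv : disp x y ≠ 0) :
    chart (unit (disp x y)) x y = (flatDist x y, 0) := by
  have h := sq_add_sq_pos hv
  have hs := Real.sqrt_pos.2 h
  have hq := Real.sq_sqrt h.le
  unfold chart unit
  rw [flatDist_eq_disp]
  refine Prod.ext ?_ ?_
  · simp only
    field_simp
    linarith
  · simp only
    field_simp
    ring

/-- In the frame of the edge, `xy` is the segment from 0 to `flatDist x y` on the first axis. The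
line from `a` through the origin has slope `α / β`, and `b` lies beyond the axis, displaced from
that line by less than `ℓ` along the axis. So `ab` meets the axis strictly between 0 and `ℓ`. -/
theorem edges_cross {x y a b : Torus} {r ℓ : ℝ} (hr : 0 < r) (hr' : r ≤ 1 / 2) (hℓ : 0 < ℓ)
    (hℓr : ℓ ≤ r / 32) (hd : ℓ ≤ flatDist x y) {α β : ℝ}
    (ha : chart (unit (disp x y)) x a = (α, β)) (hβ : β ∈ Set.Ioo (r / 8) (r / 4))
    (hα : 0 < α) (hαβ : α < β / 2)
    (hb : chart (unit (disp x y)) x b ∈ strip (-(r / 4)) (-(r / 8)) (α / β) ℓ) :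
    flatDist a b ≤ r ∧ ¬ Disjoint (edgeInterior x y) (edgePoints a b) := by
  have hdpos : 0 < flatDist x y := hℓ.trans_le hd
  have hv : disp x y ≠ 0 := by
    intro h
    rw [flatDist_eq_disp, h] at hdpos
    simp at hdpos
  have hu := unit_sq hv
  set u := unit (disp x y) with hudef
  obtain ⟨ξ, η, hbp⟩ : ∃ ξ η, chart u x b = (ξ, η) := ⟨_, _, rfl⟩
  rw [hbp] at hb
  obtain ⟨⟨hη1, hη2⟩, hξ1, hξ2⟩ := hb
  simp only at hη1 hη2 hξ1 hξ2
  obtain ⟨hβ1, hβ2⟩ := hβ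
  have hβ0 : 0 < β := by linarith
  set σ := α / β with hσ
  have hασ : α = σ * β := by rw [hσ]; field_simp
  have hσ0 : 0 < σ := div_pos hα hβ0
  have hσ1 : σ < 1 / 2 := by rw [hσ, div_lt_iff₀ hβ0]; linarith
  have hξlow : -(r / 8) < ξ := by nlinarith
  have hξup : ξ < r / 32 := by nlinarith
  have hdab : dist (framePoint u x (α, β)) (framePoint u x (ξ, η)) ≤ r := by
    rw [dist_framePoint hu]
    refine Real.sqrt_le_iff.2 ⟨hr.le, ?_⟩
    simp only
    have h1 : (α - ξ) ^ 2 ≤ (r / 2) ^ 2 := sq_le_sq' (by linarith) (by linarith)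
    have h2 : (β - η) ^ 2 ≤ (r / 2) ^ 2 := sq_le_sq' (by linarith) (by linarith)
    nlinarith
  have hpa : proj (framePoint u x (α, β)) = a := by rw [← ha]; exact proj_framePoint_chart hu x a
  have hpb : proj (framePoint u x (ξ, η)) = b := by rw [← hbp]; exact proj_framePoint_chart hu x b
  -- Since `r ≤ 1 / 2`, the planar segment is a shortest lift of the edge `ab`.
  have hab := flatDist_proj (hdab.trans hr')
  rw [hpa, hpb] at hab
  refine ⟨hab ▸ hdab, Set.not_disjoint_iff.2 ?_⟩
  have hbe : 0 < β - η := by linarith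
  -- The parameter at which the segment from `(α, β)` to `(ξ, η)` reaches the first axis.
  set t := β / (β - η) with ht
  have ht0 : 0 < t := div_pos hβ0 hbe
  have ht1 : t < 1 := by rw [ht, div_lt_one hbe]; linarith
  have hη0 : (1 - t) * β + t * η = 0 := by rw [ht]; field_simp; ring
  set c := (1 - t) * α + t * ξ with hc
  have hc' : c = t * (ξ - σ * η) := by
    rw [hc, hασ]; linear_combination σ * hη0
  have hc0 : 0 < c := by rw [hc']; exact mul_pos ht0 (by linarith)
  have hcℓ : c < flatDist x y := by rw [hc']; nlinarith
  refine ⟨proj (framePoint u x (c, 0)), ?_, ?_⟩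
  · refine ⟨framePoint u x 0, framePoint u x (flatDist x y, 0), ⟨proj_framePoint_zero u x, ?_, ?_⟩,
      _, ?_, rfl⟩
    · rw [← chart_unit_disp hv]; exact proj_framePoint_chart hu x y
    · rw [dist_framePoint hu]
      simp [Real.sqrt_sq hdpos.le]
    · rw [openSegment_eq_image]
      refine ⟨c / flatDist x y, ⟨by positivity, (div_lt_one hdpos).2 hcℓ⟩, ?_⟩
      simp only
      rw [framePoint_combo]
      congr 1
      simp [hdpos.ne']
  · refine ⟨framePoint u x (α, β), framePoint u x (ξ, η), ⟨hpa, hpb, hab.symm⟩, _, ?_, rfl⟩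
    rw [segment_eq_image]
    refine ⟨t, ⟨ht0.le, ht1.le⟩, ?_⟩
    simp only
    rw [framePoint_combo]
    simp only [hη0, hc]

/-! ### Close points, existence of edges, collinear points -/

theorem uniformPoints_near_le {n : ℕ} {i : Fin n} {J : Finset (Fin n)} (hi : i ∉ J) {ρ : ℝ}
    (hρ : 0 ≤ ρ) :
    uniformPoints n {X | ∀ l ∈ J, near ρ (X i) (X l)} ≤ ENNReal.ofReal ((4 * ρ ^ 2) ^ J.card) := by
  rw [ENNReal.ofReal_pow (by positivity)]
  have h := uniformPoints_confined_le J (fun _ => True) (fun X z => near ρ (X i) z)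
    (by simp) ?_ (fun _ _ _ _ => trivial) ?_ (fun X _ => volume_near_le hρ (X i))
  · simpa using h
  · have hm : Measurable fun p : (Fin n → Torus) × Torus => (p.1 i, p.2) := by fun_prop
    exact hm (measurableSet_near ρ)
  · intro X Y h z hz
    rw [← h i hi]; exact hz

/-- The first m points, being pairwise non-adjacent, carry disjoint squares of side `ρ / 2`. Each of
the next m points avoids their union, of area `m * (ρ / 2) ^ 2`, and `1 - p ≤ exp (-p)`. -/
theorem uniformPoints_no_edge_le {n m : ℕ} (hmn : 2 * m ≤ n) {ρ : ℝ} (hρ : 0 < ρ) (hρ2 : ρ ≤ 2) :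
    uniformPoints n {X | ∀ i j : Fin n, i.val < 2 * m → j.val < 2 * m → ¬ (diskGraph X ρ).Adj i j}
      ≤ ENNReal.ofReal (Real.exp (-(m * ρ / 2) ^ 2)) := by
  classical
  set K : Finset (Fin n) := (Finset.range m).attachFin
    (fun i hi => by have := Finset.mem_range.1 hi; omega) with hK
  set J : Finset (Fin n) := (Finset.Ico m (2 * m)).attachFin
    (fun i hi => by have := Finset.mem_Ico.1 hi; omega) with hJ
  have hKJ : ∀ k ∈ K, k ∉ J := by
    intro k hk hk'
    simp only [hK, hJ, Finset.mem_attachFin, Finset.mem_range, Finset.mem_Ico] at hk hk'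
    omega
  have hJc : J.card = m := by rw [hJ, Finset.card_attachFin, Nat.card_Ico]; omega
  have hKc : K.card = m := by rw [hK, Finset.card_attachFin, Finset.card_range]
  have hnear : ∀ (k : Fin n) (σ : ℝ), MeasurableSet {p : (Fin n → Torus) × Torus |
      near σ (p.1 k) p.2} := fun k σ => by
    have hm : Measurable fun p : (Fin n → Torus) × Torus => (p.1 k, p.2) := by fun_prop
    exact hm (measurableSet_near σ)
  have hnear' : ∀ (x : Torus) (σ : ℝ), MeasurableSet {z : Torus | near σ x z} := fun x σ => by
    have hm : Measurable fun z : Torus => (x, z) := by fun_prop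
    exact hm (measurableSet_near σ)
  have key := uniformPoints_confined_le J
    (fun X => ∀ i ∈ K, ∀ j ∈ K, i ≠ j → ¬ near (ρ / 2) (X i) (X j))
    (fun X z => ∀ k ∈ K, ¬ near (ρ / 4) (X k) z) ?_ ?_ ?_ ?_
    (c := ENNReal.ofReal (Real.exp (-(m * (ρ / 2) ^ 2)))) ?_
  · rw [hJc, ← ENNReal.ofReal_pow (Real.exp_nonneg _), ← Real.exp_nat_mul] at key
    refine (measure_mono ?_).trans (key.trans (le_of_eq ?_))
    · intro X hX
      have hX' : ∀ i j : Fin n, i.val < 2 * m → j.val < 2 * m → i ≠ j →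
          ¬ near (ρ / 2) (X i) (X j) := by
        intro i j hi hj hij hn
        refine hX i j hi hj ⟨hij, ?_⟩
        have := flatDist_le_of_near (by linarith) hn
        linarith
      have hKm : ∀ k ∈ K, k.val < m := fun k hk => by simpa [hK] using hk
      refine ⟨fun i hi j hj => hX' i j ?_ ?_, fun l hl k hk hn => hX' k l ?_ ?_ ?_ ?_⟩
      · have := hKm i hi; omega
      · have := hKm j hj; omega
      · have := hKm k hk; omega
      · simp only [hJ, Finset.mem_attachFin, Finset.mem_Ico] at hl; omega
      · rintro rfl; exact hKJ _ hk hl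
      · intro i; linarith [hn i]
    · congr 2; ring
  · have : {X : Fin n → Torus | ∀ i ∈ K, ∀ j ∈ K, i ≠ j → ¬ near (ρ / 2) (X i) (X j)}
        = ⋂ i ∈ K, ⋂ j ∈ K, {X | i = j} ∪ {X | near (ρ / 2) (X i) (X j)}ᶜ := by
      ext X
      simp only [Set.mem_ofPred_eq, Set.mem_iInter, Set.mem_union, Set.mem_compl_iff, or_iff_not_imp_left]
    rw [this]
    refine Finset.measurableSet_biInter _ fun i _ => Finset.measurableSet_biInter _ fun j _ => ?_
    refine (MeasurableSet.const _).union (MeasurableSet.compl ?_)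
    have hm : Measurable fun X : (Fin n → Torus) => (X i, X j) := by fun_prop
    exact hm (measurableSet_near _)
  · have : {p : (Fin n → Torus) × Torus | ∀ k ∈ K, ¬ near (ρ / 4) (p.1 k) p.2}
        = ⋂ k ∈ K, {p | near (ρ / 4) (p.1 k) p.2}ᶜ := by
      ext p; simp
    rw [this]
    exact Finset.measurableSet_biInter _ fun k _ => (hnear k _).compl
  · intro X Y h hX i hi j hj hij
    rw [← h i (hKJ i hi), ← h j (hKJ j hj)]
    exact hX i hi j hj hij
  · intro X Y h z hz k hk
    rw [← h k (hKJ k hk)]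
    exact hz k hk
  · intro X hX
    have hS : {z | ∀ k ∈ K, ¬ near (ρ / 4) (X k) z} = (⋃ k ∈ K, {z | near (ρ / 4) (X k) z})ᶜ := by
      ext z; simp
    rw [hS]
    refine volume_compl_le_exp (Finset.measurableSet_biUnion _ fun k _ => hnear' _ _) ?_
    rw [measure_biUnion_finset ?_ fun k _ => hnear' _ _]
    · simp only [volume_near]
      rw [Finset.sum_const, hKc, min_eq_right (by linarith), nsmul_eq_mul,
        ENNReal.ofReal_mul (Nat.cast_nonneg _), ENNReal.ofReal_pow (by positivity),
        ENNReal.ofReal_natCast]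
      exact le_of_eq (by congr 3; ring)
    · intro i hi j hj hij
      refine Set.disjoint_left.2 fun z hz hz' => hX i hi j hj hij ?_
      have := near_trans hz (near_symm hz')
      intro l; linarith [this l]

/-- In the frame directed by `v` the equation says that the second coordinate vanishes, a null line.
-/
theorem volume_collinear {v : ℝ × ℝ} (hv : v ≠ 0) (x : Torus) :
    volume {z | v.1 * (disp x z).2 - v.2 * (disp x z).1 = 0} = 0 := by
  have hs := Real.sqrt_pos.2 (sq_add_sq_pos hv)
  have hD : MeasurableSet {p : ℝ × ℝ | p.2 = 0} :=
    measurableSet_eq_fun measurable_snd measurable_const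
  have hD0 : volume {p : ℝ × ℝ | p.2 = 0} = 0 := by
    have : {p : ℝ × ℝ | p.2 = 0} = Set.univ ×ˢ {0} := by ext p; simp
    rw [this, Measure.volume_eq_prod, Measure.prod_prod]
    simp
  have h := volume_chart_preimage_le (unit_sq hv) x hD
  rw [hD0] at h
  refine measure_mono_null ?_ (le_antisymm h (zero_le))
  intro z hz
  simp only [Set.mem_ofPred_eq, chart, unit] at hz ⊢
  field_simp
  linarith

theorem uniformPoints_collinear {n : ℕ} {i j l : Fin n} (hij : i ≠ j) (hil : i ≠ l) (hjl : j ≠ l) :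
    uniformPoints n {X | (disp (X i) (X j)).1 * (disp (X i) (X l)).2
      - (disp (X i) (X j)).2 * (disp (X i) (X l)).1 = 0} = 0 := by
  -- Radius 0: the event that `X i` and `X j` coincide is null, which leaves `disp (X i) (X j) ≠ 0`.
  have h1 := uniformPoints_near_le (n := n) (i := i) (J := {j}) (by simpa using hij) le_rfl
  have hm : Measurable fun X : Fin n → Torus => disp (X i) (X j) :=
    (measurable_pi_apply i).torusDisp (measurable_pi_apply j)
  have h2 := uniformPoints_confined_le {l} (fun X : Fin n → Torus => disp (X i) (X j) ≠ 0)
    (fun X z => (disp (X i) (X j)).1 * (disp (X i) z).2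
      - (disp (X i) (X j)).2 * (disp (X i) z).1 = 0) ?_ ?_ ?_ ?_ (c := 0) ?_
  · refine measure_mono_null (t := {X | ∀ k ∈ ({j} : Finset (Fin n)), near 0 (X i) (X k)} ∪ _) ?_
      (measure_union_null (le_antisymm (h1.trans ?_) zero_le)
        (le_antisymm (h2.trans ?_) zero_le))
    · intro X hX
      by_cases hd : disp (X i) (X j) = 0
      · left
        intro k hk
        rw [Finset.mem_singleton.1 hk]
        refine near_of_flatDist_le ?_
        rw [flatDist_eq_disp, hd]
        simp
      · right
        refine ⟨hd, fun k hk => ?_⟩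
        rw [Finset.mem_singleton.1 hk]
        exact hX
    · simp
    · simp
  · exact (measurableSet_eq_fun hm measurable_const).compl
  · have hm1 : Measurable fun p : (Fin n → Torus) × Torus => disp (p.1 i) (p.1 j) :=
      hm.comp measurable_fst
    have hm2 : Measurable fun p : (Fin n → Torus) × Torus => disp (p.1 i) p.2 :=
      ((measurable_pi_apply i).comp measurable_fst).torusDisp measurable_snd
    exact measurableSet_eq_fun ((hm1.fst.mul hm2.snd).sub (hm1.snd.mul hm2.fst)) measurable_const
  · intro X Y h hX
    rw [← h i (by simpa using hil), ← h j (by simpa using hjl)]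
    exact hX
  · intro X Y h z hz
    rw [← h i (by simpa using hil), ← h j (by simpa using hjl)]
    exact hz
  · intro X hX
    exact (volume_collinear hX _).le

/-! ### Edges that are not free are rare in the sparse regimes -/

theorem uniformPoints_adj_le (n : ℕ) {ρ : ℝ} (hρ : 0 ≤ ρ) :
    uniformPoints n {X | ∃ i j, (diskGraph X ρ).Adj i j}
      ≤ ENNReal.ofReal ((n : ℝ) ^ 2 * (4 * ρ ^ 2)) := by
  have h := uniformPoints_exists_le (n := n) (Finset.univ : Finset (Fin n × Fin n))
    (fun q X => q.1 ≠ q.2 ∧ near ρ (X q.1) (X q.2)) (c := 4 * ρ ^ 2) ?_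
  · refine (measure_mono ?_).trans (h.trans (le_of_eq ?_))
    · rintro X ⟨i, j, hij⟩
      exact ⟨(i, j), Finset.mem_univ _, hij.1, near_of_flatDist_le hij.2⟩
    · congr 1
      simp only [Finset.card_univ, Fintype.card_prod, Fintype.card_fin]
      push_cast
      ring
  · rintro ⟨i, j⟩ -
    by_cases hij : i = j
    · simp [hij]
    · have := uniformPoints_near_le (n := n) (i := i) (J := {j}) (by simpa using hij) hρ
      simpa [hij] using this

/-- A crossing edge disjoint from `ij` as a pair puts three further points in the box of area at
most `16 * ρ ^ 2` around `X i`. One sharing a vertex with `ij` forces three collinear points, hence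
the second family of bad events, with bound 0. -/
theorem uniformPoints_not_all_free_le (n : ℕ) {ρ : ℝ} (hρ : 0 ≤ ρ) (hρ2 : ρ < 1 / 2) :
    uniformPoints n {X | ∃ i j, (diskGraph X ρ).Adj i j ∧ ¬ IsFreeEdge X ρ i j}
      ≤ ENNReal.ofReal ((n : ℝ) ^ 4 * (16 * ρ ^ 2) ^ 3) := by
  have h1 := uniformPoints_exists_le (n := n) (Finset.univ : Finset (Fin n × Fin n × Fin n × Fin n))
    (fun q X => (q.1 ≠ q.2.1 ∧ q.1 ≠ q.2.2.1 ∧ q.1 ≠ q.2.2.2 ∧ q.2.1 ≠ q.2.2.1 ∧ q.2.1 ≠ q.2.2.2 ∧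
      q.2.2.1 ≠ q.2.2.2) ∧ near (2 * ρ) (X q.1) (X q.2.1) ∧ near (2 * ρ) (X q.1) (X q.2.2.1) ∧
      near (2 * ρ) (X q.1) (X q.2.2.2)) (c := (16 * ρ ^ 2) ^ 3) ?_
  · have h2 := uniformPoints_exists_le (n := n) (Finset.univ : Finset (Fin n × Fin n × Fin n))
      (fun q X => (q.1 ≠ q.2.1 ∧ q.1 ≠ q.2.2 ∧ q.2.1 ≠ q.2.2) ∧
        (disp (X q.1) (X q.2.1)).1 * (disp (X q.1) (X q.2.2)).2
        - (disp (X q.1) (X q.2.1)).2 * (disp (X q.1) (X q.2.2)).1 = 0) (c := 0) ?_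
    · have h3 := uniformPoints_or_le (C := fun X : Fin n → Torus =>
        ∃ i j, (diskGraph X ρ).Adj i j ∧ ¬ IsFreeEdge X ρ i j) (by positivity) (by simp) h1 h2 ?_
      · refine h3.trans (le_of_eq ?_)
        congr 1
        simp only [Finset.card_univ, Fintype.card_prod, Fintype.card_fin, mul_zero, add_zero]
        push_cast
        ring
      · rintro X ⟨i, j, hij, hfree⟩
        obtain ⟨k, l, hkl, hne, hk, hl, z, hz1, hz2⟩ := exists_near_of_not_isFreeEdge hij hfree
        have hd : ∀ {a b : Fin n}, (diskGraph X ρ).Adj a b → flatDist (X a) (X b) < 1 / 2 :=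
          fun h => h.2.trans_lt hρ2
        have hj : near (2 * ρ) (X i) (X j) := near_mono (by linarith) (near_of_flatDist_le hij.2)
        have hz1' := hz1
        have hz2' := hz2
        rw [edgeInterior_comm] at hz1'
        rw [edgePoints_comm] at hz2'
        by_cases hki : k = i
        · subst hki
          refine Or.inr ⟨(k, j, l), Finset.mem_univ _, ⟨hij.1, hkl.1, ?_⟩, ?_⟩
          · show j ≠ l
            rintro rfl; exact hne rfl
          · exact collinear_of_edges_meet (hd hij) (hd hkl) hz1 hz2
        by_cases hkj : k = j
        · subst hkj
          refine Or.inr ⟨(k, i, l), Finset.mem_univ _, ⟨hij.1.symm, hkl.1, ?_⟩, ?_⟩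
          · show i ≠ l
            rintro rfl; exact hne Sym2.eq_swap
          · exact collinear_of_edges_meet (hd hij.symm) (hd hkl) hz1' hz2
        by_cases hli : l = i
        · subst hli
          refine Or.inr ⟨(l, j, k), Finset.mem_univ _, ⟨hij.1, hkl.1.symm, Ne.symm hkj⟩, ?_⟩
          exact collinear_of_edges_meet (hd hij) (hd hkl.symm) hz1 hz2'
        by_cases hlj : l = j
        · subst hlj
          refine Or.inr ⟨(l, i, k), Finset.mem_univ _, ⟨hij.1.symm, hkl.1.symm, Ne.symm hki⟩, ?_⟩
          exact collinear_of_edges_meet (hd hij.symm) (hd hkl.symm) hz1' hz2'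
        exact Or.inl ⟨(i, j, k, l), Finset.mem_univ _, ⟨hij.1, Ne.symm hki, Ne.symm hli,
          Ne.symm hkj, Ne.symm hlj, hkl.1⟩, hj, hk, hl⟩
    · rintro ⟨i, j, l⟩ -
      by_cases hd : i ≠ j ∧ i ≠ l ∧ j ≠ l
      · refine (measure_mono fun X hX => ?_).trans
          (uniformPoints_collinear hd.1 hd.2.1 hd.2.2).le |>.trans zero_le
        exact hX.2
      · simp [hd]
  · rintro ⟨i, j, k, l⟩ -
    by_cases hd : i ≠ j ∧ i ≠ k ∧ i ≠ l ∧ j ≠ k ∧ j ≠ l ∧ k ≠ l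
    · obtain ⟨hij, hik, hil, hjk, hjl, hkl⟩ := hd
      have := uniformPoints_near_le (n := n) (i := i) (J := {j, k, l}) (by simp [hij, hik, hil])
        (show 0 ≤ 2 * ρ by linarith)
      rw [Finset.card_eq_three.2 ⟨j, k, l, hjk, hjl, hkl, rfl⟩] at this
      refine (measure_mono fun X hX => ?_).trans (this.trans (le_of_eq (by congr 1; ring)))
      simpa using hX.2
    · simp [hd]

/-- A crossing edge differs from `ij`, so at least one of its ends is a third vertex, and it lies
near `X i`. That vertex ranges over all n points, while `i` and `j` range over only m. -/
theorem uniformPoints_initial_not_free_le {n m : ℕ} (hmn : m ≤ n) {ρ : ℝ} (hρ : 0 ≤ ρ) :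
    uniformPoints n {X | ∃ i j : Fin n, i.val < m ∧ j.val < m ∧ (diskGraph X ρ).Adj i j ∧
      ¬ IsFreeEdge X ρ i j} ≤ ENNReal.ofReal ((m : ℝ) ^ 2 * n * (16 * ρ ^ 2) ^ 2) := by
  classical
  set K : Finset (Fin n) := (Finset.range m).attachFin
    (fun i hi => by have := Finset.mem_range.1 hi; omega) with hK
  have hKc : K.card = m := by rw [hK, Finset.card_attachFin, Finset.card_range]
  have h1 := uniformPoints_exists_le (n := n) (K ×ˢ K ×ˢ (Finset.univ : Finset (Fin n)))
    (fun q X => (q.1 ≠ q.2.1 ∧ q.1 ≠ q.2.2 ∧ q.2.1 ≠ q.2.2) ∧ near (2 * ρ) (X q.1) (X q.2.1) ∧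
      near (2 * ρ) (X q.1) (X q.2.2)) (c := (16 * ρ ^ 2) ^ 2) ?_
  · refine (measure_mono ?_).trans (h1.trans (le_of_eq ?_))
    · rintro X ⟨i, j, hi, hj, hij, hfree⟩
      obtain ⟨k, l, hkl, hne, hk, hl, -⟩ := exists_near_of_not_isFreeEdge hij hfree
      have hjn : near (2 * ρ) (X i) (X j) := near_mono (by linarith) (near_of_flatDist_le hij.2)
      have hmem : ∀ p : Fin n, (i, j, p) ∈ K ×ˢ K ×ˢ (Finset.univ : Finset (Fin n)) := fun p => by
        simp [hK, hi, hj]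
      have hlk := hkl.1
      by_cases hkd : i ≠ k ∧ j ≠ k
      · exact ⟨(i, j, k), hmem k, ⟨hij.1, hkd⟩, hjn, hk⟩
      · refine ⟨(i, j, l), hmem l, ⟨hij.1, ?_⟩, hjn, hl⟩
        constructor
        · show i ≠ l
          rintro rfl
          apply hkd
          refine ⟨hlk.symm, ?_⟩
          rintro rfl
          exact hne Sym2.eq_swap
        · show j ≠ l
          rintro rfl
          apply hkd
          refine ⟨?_, hlk.symm⟩
          rintro rfl
          exact hne rfl
    · congr 1
      simp only [Finset.card_product, Finset.card_univ, Fintype.card_fin, hKc]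
      push_cast
      ring
  · rintro ⟨i, j, k⟩ -
    by_cases hd : i ≠ j ∧ i ≠ k ∧ j ≠ k
    · obtain ⟨hij, hik, hjk⟩ := hd
      have := uniformPoints_near_le (n := n) (i := i) (J := {j, k}) (by simp [hij, hik])
        (show 0 ≤ 2 * ρ by linarith)
      rw [Finset.card_pair hjk] at this
      refine (measure_mono fun X hX => ?_).trans (this.trans (le_of_eq (by congr 1; ring)))
      simpa using hX.2
    · simp [hd]

/-! ### Asymptotics -/

theorem tendsto_mul_zero_of_isLittleO {r g : ℕ → ℝ} (h : r =o[atTop] fun n => 1 / g n) :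
    Tendsto (fun n => g n * r n) atTop (𝓝 0) := by
  refine (h.tendsto_div_nhds_zero).congr fun n => ?_
  rw [div_div_eq_mul_div, div_one, mul_comm]

theorem tendsto_mul_atTop_of_isLittleO {r g : ℕ → ℝ} (hg : ∀ᶠ n in atTop, 0 < g n)
    (hr : ∀ n, 0 < r n) (h : (fun n => 1 / g n) =o[atTop] r) :
    Tendsto (fun n => g n * r n) atTop atTop := by
  have h1 : Tendsto (fun n => 1 / g n / r n) atTop (𝓝[>] 0) := by
    refine tendsto_nhdsWithin_iff.2 ⟨h.tendsto_div_nhds_zero, ?_⟩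
    filter_upwards [hg] with n hn
    have := hr n
    exact Set.mem_Ioi.2 (by positivity)
  refine h1.inv_tendsto_nhdsGT_zero.congr fun n => ?_
  simp [mul_comm]

theorem eventually_natCast_pos : ∀ᶠ n : ℕ in atTop, 0 < (n : ℝ) := by
  filter_upwards [eventually_gt_atTop 0] with n hn
  exact_mod_cast hn

theorem whp_no_edge {r : ℕ → ℝ} (hpos : ∀ n, 0 < r n) (h : r =o[atTop] fun n : ℕ => 1 / (n : ℝ)) :
    WHP fun n X => ∀ i j, ¬ (diskGraph X (r n)).Adj i j := by
  have h1 := tendsto_mul_zero_of_isLittleO h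
  refine WHP_of_bad (b := fun n => 4 * ((n : ℝ) * r n) ^ 2) (by simpa using (h1.pow 2).const_mul 4)
    (Eventually.of_forall fun n => ?_)
  refine (measure_mono ?_).trans ((uniformPoints_adj_le n (hpos n).le).trans (le_of_eq ?_))
  · intro X hX
    simpa using hX
  · congr 1; ring

theorem tendsto_exp_neg_sq {ι : Type*} {l : Filter ι} {f : ι → ℝ} (hf : Tendsto f l atTop) :
    Tendsto (fun i => Real.exp (-(f i) ^ 2)) l (𝓝 0) :=
  Real.tendsto_exp_neg_atTop_nhds_zero.comp ((tendsto_pow_atTop two_ne_zero).comp hf)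

theorem whp_edges_all_free {r : ℕ → ℝ} (hpos : ∀ n, 0 < r n) (hzero : Tendsto r atTop (𝓝 0))
    (h1 : (fun n : ℕ => 1 / (n : ℝ)) =o[atTop] r)
    (h2 : r =o[atTop] fun n : ℕ => 1 / (n : ℝ) ^ (2 / 3 : ℝ)) :
    WHP fun n X => (∃ i j, (diskGraph X (r n)).Adj i j) ∧
      ∀ i j, (diskGraph X (r n)).Adj i j → IsFreeEdge X (r n) i j := by
  have h1' := tendsto_mul_atTop_of_isLittleO eventually_natCast_pos hpos h1
  have h2' := tendsto_mul_zero_of_isLittleO h2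
  have hb1 := tendsto_exp_neg_sq (h1'.atTop_div_const (show (0 : ℝ) < 8 by norm_num))
  have hb2 := (h2'.pow 6).const_mul 4096
  have hb := hb1.add hb2
  refine WHP_of_bad (b := _) (by simpa using hb) ?_
  filter_upwards [eventually_ge_atTop 2, hzero.eventually (gt_mem_nhds (show (0 : ℝ) < 1 / 2 by norm_num))]
    -- For `n ≥ 2`, `n / 2` rounded down is at least n/4, which accounts for the 8 in the exponent.
    with n hn hr
  have hr0 := hpos n
  have hE := uniformPoints_no_edge_le (n := n) (m := n / 2) (by omega) hr0 (by linarith)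
  have hF := uniformPoints_not_all_free_le n hr0.le hr
  have hE' : uniformPoints n {X | ∀ i j : Fin n, ¬ (diskGraph X (r n)).Adj i j}
      ≤ ENNReal.ofReal (Real.exp (-(n * r n / 8) ^ 2)) := by
    refine (measure_mono ?_).trans (hE.trans (ENNReal.ofReal_le_ofReal (Real.exp_le_exp.2 ?_)))
    · intro X hX i j _ _
      exact hX i j
    · have hm : (n : ℝ) / 4 ≤ ((n / 2 : ℕ) : ℝ) := by
        have : n ≤ 4 * (n / 2) := by omega
        have : (n : ℝ) ≤ 4 * ((n / 2 : ℕ) : ℝ) := by exact_mod_cast this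
        linarith
      rw [neg_le_neg_iff]
      refine pow_le_pow_left₀ (by positivity) ?_ 2
      nlinarith
  have hF' : (n : ℝ) ^ 4 * (16 * r n ^ 2) ^ 3 = 4096 * ((n : ℝ) ^ (2 / 3 : ℝ) * r n) ^ 6 := by
    have : ((n : ℝ) ^ (2 / 3 : ℝ)) ^ 6 = (n : ℝ) ^ 4 := by
      rw [← Real.rpow_natCast, ← Real.rpow_mul (Nat.cast_nonneg _), ← Real.rpow_natCast]
      norm_num
    rw [mul_pow ((n : ℝ) ^ (2 / 3 : ℝ)), this]; ring
  rw [hF'] at hF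
  refine uniformPoints_or_le (Real.exp_nonneg _) (by positivity) hE' hF ?_
  intro X hX
  by_cases hedge : ∃ i j, (diskGraph X (r n)).Adj i j
  · right
    by_contra hc
    refine hX ⟨hedge, fun i j hij => ?_⟩
    by_contra hf
    exact hc ⟨i, j, hij, hf⟩
  · left
    intro i j hij
    exact hedge ⟨i, j, hij⟩

theorem whp_exists_free_edge {r : ℕ → ℝ} (hpos : ∀ n, 0 < r n) (hzero : Tendsto r atTop (𝓝 0))
    {ε : ℝ} (hε : 0 < ε) (h1 : (fun n : ℕ => 1 / (n : ℝ) ^ (2 / 3 : ℝ)) =o[atTop] r)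
    (h2 : r =o[atTop] fun n : ℕ => 1 / (n : ℝ) ^ (1 / 2 + ε : ℝ)) :
    WHP fun n X => ∃ i j, IsFreeEdge X (r n) i j := by
  have h1' := tendsto_mul_atTop_of_isLittleO
    (eventually_natCast_pos.mono fun n hn => Real.rpow_pos_of_pos hn _) hpos h1
  have h2' := tendsto_mul_zero_of_isLittleO h2
  -- the average degree
  set q : ℕ → ℝ := fun n => n * r n ^ 2 with hq
  have hq0 : Tendsto q atTop (𝓝 0) := by
    have := h2'.pow 2
    rw [zero_pow two_ne_zero] at this
    refine squeeze_zero' (Eventually.of_forall fun n => by positivity) ?_ this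
    filter_upwards [eventually_ge_atTop 1] with n hn
    have hn' : (1 : ℝ) ≤ n := by exact_mod_cast hn
    rw [mul_pow]
    refine mul_le_mul_of_nonneg_right ?_ (sq_nonneg _)
    rw [← Real.rpow_natCast, ← Real.rpow_mul (by linarith)]
    refine (Real.self_le_rpow_of_one_le hn' ?_)
    push_cast; linarith
  have hqpos : ∀ᶠ n in atTop, 0 < q n := by
    filter_upwards [eventually_natCast_pos] with n hn
    have := hpos n
    positivity
  have hsq : Tendsto (fun n => Real.sqrt (q n)) atTop (𝓝 0) := by
    simpa using hq0.sqrt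
  have hssq : Tendsto (fun n => Real.sqrt (Real.sqrt (q n))) atTop (𝓝 0) := by
    simpa using hsq.sqrt
  -- Any t → ∞ with t²q → 0 would serve, being the size of mr; the choice t = q^(-1/4) gives t²q =
  -- √q.
  set t : ℕ → ℝ := fun n => (Real.sqrt (Real.sqrt (q n)))⁻¹ with ht
  have htop : Tendsto t atTop atTop := by
    refine Tendsto.inv_tendsto_nhdsGT_zero (tendsto_nhdsWithin_iff.2 ⟨hssq, ?_⟩)
    filter_upwards [hqpos] with n hn
    exact Real.sqrt_pos.2 (Real.sqrt_pos.2 hn)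
  have hb := (tendsto_exp_neg_sq (htop.atTop_div_const (show (0 : ℝ) < 2 by norm_num))).add
    (hsq.const_mul 4096)
  refine WHP_of_bad (b := _) (by simpa using hb) ?_
  filter_upwards [eventually_ge_atTop 1, hqpos, htop.eventually_ge_atTop 1, h1'.eventually_ge_atTop 4,
    hzero.eventually (gt_mem_nhds (show (0 : ℝ) < 1 / 2 by norm_num))] with n hn hqn htn h1n hr
  have hr0 := hpos n
  have hn' : (1 : ℝ) ≤ n := by exact_mod_cast hn
  have ht2 : t n ^ 2 * q n = Real.sqrt (q n) := by
    have h := Real.sqrt_pos.2 hqn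
    rw [ht]
    simp only [inv_pow, Real.sq_sqrt h.le]
    rw [inv_mul_eq_iff_eq_mul₀ h.ne', Real.mul_self_sqrt hqn.le]
  have ht4 : t n ^ 4 * q n = 1 := by
    have h := Real.sqrt_pos.2 hqn
    have : t n ^ 4 = (q n)⁻¹ := by
      rw [ht]
      simp only [inv_pow]
      rw [show (4 : ℕ) = 2 * 2 from rfl, pow_mul, Real.sq_sqrt h.le, Real.sq_sqrt hqn.le]
    rw [this, inv_mul_cancel₀ hqn.ne']
  -- This makes 2m ≤ n. It follows by comparing fourth powers after multiplication by q: (nr)⁴q = n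
  -- · n⁴r⁶, and n⁴r⁶ is large by the lower bound on r.
  have htn4 : 4 * t n ≤ n * r n := by
    have hw : (4 : ℝ) ^ 6 ≤ n ^ 4 * r n ^ 6 := by
      have h := pow_le_pow_left₀ (by norm_num) h1n 6
      rw [mul_pow] at h
      have : ((n : ℝ) ^ (2 / 3 : ℝ)) ^ 6 = (n : ℝ) ^ 4 := by
        rw [← Real.rpow_natCast, ← Real.rpow_mul (Nat.cast_nonneg _), ← Real.rpow_natCast]
        norm_num
      rwa [this] at h
    refine le_of_pow_le_pow_left₀ (n := 4) (by norm_num) (by positivity) ?_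
    have h3 : (4 * t n) ^ 4 * q n = 256 := by linear_combination 256 * ht4
    refine le_of_mul_le_mul_right ?_ hqn
    rw [h3, hq]
    have : (n * r n) ^ 4 * (n * r n ^ 2) = n * ((n : ℝ) ^ 4 * r n ^ 6) := by ring
    simp only
    rw [this]
    nlinarith
  set m := ⌈t n / r n⌉₊ with hm
  have hm1 : t n ≤ m * r n := by
    have := Nat.le_ceil (t n / r n)
    rwa [div_le_iff₀ hr0] at this
  have hm2 : m * r n ≤ 2 * t n := by
    have h := Nat.ceil_lt_add_one (show 0 ≤ t n / r n by positivity)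
    have h' : (m : ℝ) * r n ≤ (t n / r n + 1) * r n := mul_le_mul_of_nonneg_right h.le hr0.le
    rw [add_mul, div_mul_cancel₀ _ hr0.ne'] at h'
    linarith
  have hmn : 2 * m ≤ n := by
    have : (2 * m : ℝ) * r n ≤ n * r n := by linarith
    exact_mod_cast le_of_mul_le_mul_right this hr0
  have hE := uniformPoints_no_edge_le hmn hr0 (by linarith)
  have hF := uniformPoints_initial_not_free_le hmn hr0.le
  have hE' := hE.trans (ENNReal.ofReal_le_ofReal (Real.exp_le_exp.2
    (neg_le_neg (pow_le_pow_left₀ (show 0 ≤ t n / 2 by positivity)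
      (div_le_div_of_nonneg_right hm1 zero_le_two) 2))))
  have hF' : ((2 * m : ℕ) : ℝ) ^ 2 * n * (16 * r n ^ 2) ^ 2 ≤ 4096 * Real.sqrt (q n) := by
    have h : (m * r n) ^ 2 ≤ (2 * t n) ^ 2 := pow_le_pow_left₀ (by positivity) hm2 2
    have h' := mul_le_mul_of_nonneg_right h hqn.le
    calc ((2 * m : ℕ) : ℝ) ^ 2 * n * (16 * r n ^ 2) ^ 2 = 1024 * ((m * r n) ^ 2 * q n) := by
          rw [hq]; push_cast; ring
      _ ≤ 1024 * ((2 * t n) ^ 2 * q n) := by linarith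
      _ = 4096 * Real.sqrt (q n) := by rw [← ht2]; ring
  refine uniformPoints_or_le (Real.exp_nonneg _) (by positivity) hE'
    (hF.trans (ENNReal.ofReal_le_ofReal hF')) ?_
  intro X hX
  by_contra hc
  push Not at hc
  obtain ⟨⟨i, j, hi, hj, hij⟩, hfree⟩ := hc
  exact hX ⟨i, j, hfree i j hi hj hij⟩

/-! ### Every edge is crossed in the dense regime -/

theorem measurableSet_strip (c d σ w : ℝ) : MeasurableSet (strip c d σ w) := by
  have : strip c d σ w = {p | c < p.2} ∩ {p | p.2 < d} ∩ {p | σ * p.2 < p.1} ∩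
      {p | p.1 < σ * p.2 + w} := by
    ext p; simp [strip, and_assoc]
  rw [this]
  refine (((measurableSet_lt ?_ ?_).inter (measurableSet_lt ?_ ?_)).inter
    (measurableSet_lt ?_ ?_)).inter (measurableSet_lt ?_ ?_) <;> fun_prop

theorem volume_strip (c d σ : ℝ) {w : ℝ} (hw : 0 ≤ w) :
    volume (strip c d σ w) = ENNReal.ofReal (w * (d - c)) := by
  rw [Measure.volume_eq_prod, Measure.prod_apply_symm (measurableSet_strip c d σ w)]
  have : ∀ y, volume ((fun x => (x, y)) ⁻¹' strip c d σ w)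
      = (Set.Ioo c d).indicator (fun _ => ENNReal.ofReal w) y := by
    intro y
    by_cases hy : y ∈ Set.Ioo c d
    · have h : (fun x => (x, y)) ⁻¹' strip c d σ w = Set.Ioo (σ * y) (σ * y + w) := by
        ext x
        exact ⟨fun h => h.2, fun h => ⟨hy, h⟩⟩
      rw [h, Real.volume_Ioo, Set.indicator_of_mem hy]
      congr 1; ring
    · have h : (fun x => (x, y)) ⁻¹' strip c d σ w = ∅ := by
        ext x
        exact ⟨fun h => hy h.1, fun h => h.elim⟩
      rw [h, measure_empty, Set.indicator_of_notMem hy]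
  simp only [this]
  rw [lintegral_indicator measurableSet_Ioo, setLIntegral_const, Real.volume_Ioo,
    ← ENNReal.ofReal_mul hw]

/-- The coordinates of `z` in the frame of the edge `ij`. -/
noncomputable def edgeChart {n : ℕ} (X : Fin n → Torus) (i j : Fin n) (z : Torus) : ℝ × ℝ :=
  chart (unit (disp (X i) (X j))) (X i) z

theorem measurable_edgeChart {n : ℕ} (i j : Fin n) :
    Measurable fun p : (Fin n → Torus) × Torus => edgeChart p.1 i j p.2 := by
  have hi : Measurable fun p : (Fin n → Torus) × Torus => p.1 i := by fun_prop
  have hj : Measurable fun p : (Fin n → Torus) × Torus => p.1 j := by fun_prop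
  have hu := measurable_unit.comp (hi.torusDisp hj)
  have hz := hi.torusDisp (measurable_snd (α := Fin n → Torus) (β := Torus))
  exact ((hu.fst.mul hz.fst).add (hu.snd.mul hz.snd)).prodMk
    ((hu.snd.neg.mul hz.fst).add (hu.fst.mul hz.snd))

theorem measurable_edgeChart_apply {n : ℕ} (i j k : Fin n) :
    Measurable fun X : Fin n → Torus => edgeChart X i j (X k) :=
  Measurable.comp (g := fun p : (Fin n → Torus) × Torus => edgeChart p.1 i j p.2)
    (f := fun X => (X, X k)) (measurable_edgeChart i j) (by fun_prop)

theorem edgeChart_congr {n : ℕ} {X Y : Fin n → Torus} {i j : Fin n} (hi : X i = Y i)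
    (hj : X j = Y j) : edgeChart X i j = edgeChart Y i j := by
  funext z
  simp only [edgeChart, hi, hj]

/-- The `s`-th of `L` sectors on one side of an edge. -/
def sector (r : ℝ) (L s : ℕ) : Set (ℝ × ℝ) :=
  strip (r / 8) (r / 4) (2 * s / (4 * L)) (r / (32 * L))

/-- Points on the other side of the edge whose connection to `a` crosses the edge. -/
def cell (r ℓ : ℝ) (a : ℝ × ℝ) : Set (ℝ × ℝ) := strip (-(r / 4)) (-(r / 8)) (a.1 / a.2) ℓ

theorem measurableSet_cell (r ℓ : ℝ) :
    MeasurableSet {q : (ℝ × ℝ) × (ℝ × ℝ) | q.2 ∈ cell r ℓ q.1} := by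
  have : {q : (ℝ × ℝ) × (ℝ × ℝ) | q.2 ∈ cell r ℓ q.1} =
      {q | -(r / 4) < q.2.2} ∩ {q | q.2.2 < -(r / 8)} ∩ {q | q.1.1 / q.1.2 * q.2.2 < q.2.1} ∩
      {q | q.2.1 < q.1.1 / q.1.2 * q.2.2 + ℓ} := by
    ext p; simp [cell, strip, and_assoc]
  rw [this]
  refine (((measurableSet_lt ?_ ?_).inter (measurableSet_lt ?_ ?_)).inter
    (measurableSet_lt ?_ ?_)).inter (measurableSet_lt ?_ ?_) <;> fun_prop

section sectors

variable {r : ℝ} {L : ℕ}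

/-- Since `a.2 > r / 8`, the width `r / (32 * L)` changes the slope by less than `1 / (4 * L)`.
Slopes thus fill only every other interval of length `1 / (4 * L)`, leaving gaps between consecutive
sectors. -/
theorem slope_of_mem_sector (hr : 0 < r) {s : ℕ} (hs : s < L) {a : ℝ × ℝ} (ha : a ∈ sector r L s) :
    0 < a.1 ∧ 2 * s / (4 * L) < a.1 / a.2 ∧ a.1 / a.2 < (2 * s + 1) / (4 * L) ∧ a.1 < a.2 / 2 := by
  obtain ⟨⟨h1, h2⟩, h3, h4⟩ := ha
  have hL : (0 : ℝ) < L := by exact_mod_cast (Nat.zero_le s).trans_lt hs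
  have ha2 : 0 < a.2 := by linarith
  have hs' : (s : ℝ) + 1 ≤ L := by exact_mod_cast hs
  have h5 : a.1 < (2 * s + 1) / (4 * L) * a.2 := by
    have : r / (32 * L) < 1 / (4 * L) * a.2 := by
      rw [div_lt_iff₀ (by positivity)]
      field_simp
      linarith
    calc a.1 < 2 * s / (4 * L) * a.2 + r / (32 * L) := h4
      _ < 2 * s / (4 * L) * a.2 + 1 / (4 * L) * a.2 := by linarith
      _ = _ := by ring
  have h6 : (2 * s + 1) / (4 * L) < (1 / 2 : ℝ) := by
    rw [div_lt_iff₀ (by positivity)]; linarith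
  refine ⟨lt_of_le_of_lt (by positivity) h3, (lt_div_iff₀ ha2).2 h3, (div_lt_iff₀ ha2).2 h5, ?_⟩
  nlinarith

theorem sq_add_sq_lt_of_mem_sector (hr : 0 < r) (hr' : r ≤ 1 / 2) {s : ℕ} (hs : s < L)
    {a : ℝ × ℝ} (ha : a ∈ sector r L s) : a.1 ^ 2 + a.2 ^ 2 < 1 / 4 := by
  obtain ⟨h1, -, -, h4⟩ := slope_of_mem_sector hr hs ha
  obtain ⟨⟨h5, h6⟩, -⟩ := ha
  nlinarith

theorem sq_add_sq_lt_of_mem_cell {ℓ : ℝ} (hr : 0 < r) (hr' : r ≤ 1 / 2) (hℓ : ℓ ≤ r / 32) {s : ℕ}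
    (hs : s < L) {a b : ℝ × ℝ} (ha : a ∈ sector r L s) (hb : b ∈ cell r ℓ a) :
    b.1 ^ 2 + b.2 ^ 2 < 1 / 4 := by
  obtain ⟨h1, -, -, h4⟩ := slope_of_mem_sector hr hs ha
  obtain ⟨⟨h5, h6⟩, -⟩ := ha
  obtain ⟨⟨h7, h8⟩, h9, h10⟩ := hb
  have ha2 : 0 < a.2 := by linarith
  have hσ : a.1 / a.2 < 1 / 2 := by rw [div_lt_iff₀ ha2]; linarith
  have hσ0 : 0 < a.1 / a.2 := div_pos h1 ha2
  have h11 : -(1 / 8) < b.1 := by nlinarith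
  have h12 : b.1 < 1 / 8 := by nlinarith
  nlinarith

/-- Slopes from different sectors differ by more than `1 / (4 * L)`, so at depth at least `r / 8`
the two lines are more than `r / (32 * L) ≥ ℓ` apart, and strips of width `ℓ` cannot meet. -/
theorem disjoint_cell {ℓ : ℝ} (hr : 0 < r) (hℓ : 32 * L * ℓ ≤ r) {s s' : ℕ} (hss : s ≠ s')
    (hs : s < L) (hs' : s' < L) {a a' : ℝ × ℝ} (ha : a ∈ sector r L s) (ha' : a' ∈ sector r L s') :
    Disjoint (cell r ℓ a) (cell r ℓ a') := by
  wlog h : s < s' generalizing s s' a a'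
  · exact (this hss.symm hs' hs ha' ha (lt_of_le_of_ne (not_lt.1 h) hss.symm)).symm
  refine Set.disjoint_left.2 fun b hb hb' => ?_
  obtain ⟨-, -, h1, -⟩ := slope_of_mem_sector hr hs ha
  obtain ⟨-, h2, -, -⟩ := slope_of_mem_sector hr hs' ha'
  obtain ⟨⟨h3, h4⟩, h5, -⟩ := hb
  obtain ⟨-, -, h6⟩ := hb'
  have hL : (0 : ℝ) < L := by exact_mod_cast (Nat.zero_le s).trans_lt hs
  have hsr : (s : ℝ) + 1 ≤ s' := by exact_mod_cast h
  have hgap : 1 / (4 * L) < a'.1 / a'.2 - a.1 / a.2 := by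
    have : (2 * s + 1) / (4 * L) + 1 / (4 * L) ≤ 2 * s' / (4 * (L : ℝ)) := by
      rw [← add_div]
      exact div_le_div_of_nonneg_right (by linarith) (by positivity)
    linarith
  have hℓ' : ℓ ≤ 1 / (4 * L) * (r / 8) := by
    rw [div_mul_eq_mul_div, le_div_iff₀ (by positivity)]
    linarith
  have hg0 : 0 < 1 / (4 * (L : ℝ)) := by positivity
  nlinarith

end sectors

theorem measurableSet_disp_ne {n : ℕ} (i j : Fin n) :
    MeasurableSet {X : Fin n → Torus | disp (X i) (X j) ≠ 0} :=
  (measurableSet_eq_fun ((measurable_pi_apply i).torusDisp (measurable_pi_apply j))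
    measurable_const).compl

theorem uniformPoints_sector_empty_le {n : ℕ} {i j : Fin n} {A : Finset (Fin n)} (hi : i ∉ A)
    (hj : j ∉ A) {r : ℝ} (hr : 0 < r) (hr' : r ≤ 1 / 2) (L : ℕ) :
    uniformPoints n {X | disp (X i) (X j) ≠ 0 ∧ ∃ s < L, ∀ k ∈ A, edgeChart X i j (X k) ∉ sector r L s}
      ≤ ENNReal.ofReal (L * Real.exp (-(A.card * (r ^ 2 / (256 * L))))) := by
  have h := uniformPoints_exists_le (n := n) (Finset.range L)
    (fun s X => disp (X i) (X j) ≠ 0 ∧ ∀ k ∈ A, edgeChart X i j (X k) ∉ sector r L s)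
    (c := Real.exp (-(A.card * (r ^ 2 / (256 * L))))) ?_
  · rw [Finset.card_range] at h
    refine (measure_mono ?_).trans h
    rintro X ⟨h0, s, hs, hX⟩
    exact ⟨s, Finset.mem_range.2 hs, h0, hX⟩
  intro s hs
  have hs := Finset.mem_range.1 hs
  have key := uniformPoints_confined_le A (fun X => disp (X i) (X j) ≠ 0)
    (fun X z => edgeChart X i j z ∉ sector r L s) (measurableSet_disp_ne i j) ?_ ?_ ?_
    (c := ENNReal.ofReal (Real.exp (-(r ^ 2 / (256 * L))))) ?_
  · refine key.trans (le_of_eq ?_)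
    rw [← ENNReal.ofReal_pow (Real.exp_nonneg _), ← Real.exp_nat_mul]
    congr 2; ring
  · exact ((measurable_edgeChart i j) (measurableSet_strip _ _ _ _)).compl
  · intro X Y h hX
    rw [← h i hi, ← h j hj]; exact hX
  · intro X Y h z hz
    rw [← edgeChart_congr (h i hi) (h j hj)]; exact hz
  · intro X hX
    have hvol := volume_chart_preimage (unit_sq hX) (X i) (measurableSet_strip _ _ _ _)
      fun p hp => sq_add_sq_lt_of_mem_sector hr hr' hs hp
    rw [volume_strip _ _ _ (by positivity)] at hvol
    have hm : MeasurableSet {z | edgeChart X i j z ∈ sector r L s} :=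
      ((measurable_edgeChart i j).comp (measurable_const.prodMk measurable_id))
        (measurableSet_strip _ _ _ _)
    refine volume_compl_le_exp hm ?_
    refine le_of_eq (Eq.trans ?_ hvol.symm)
    congr 1
    have hL : (0 : ℝ) < L := by exact_mod_cast (Nat.zero_le s).trans_lt hs
    field_simp
    ring

/-- Conditionally on `A` and the edge, each point of `B` must avoid L disjoint cells of area `ℓ * r
/ 8`. The event mentions all points of `A` in the sectors, which keeps it measurable; one point per
sector is chosen only to bound the area. -/
theorem uniformPoints_no_crossing_le {n : ℕ} {i j : Fin n} {A B : Finset (Fin n)} (hiB : i ∉ B)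
    (hjB : j ∉ B) (hAB : Disjoint A B) {r ℓ : ℝ} (hr : 0 < r) (hr' : r ≤ 1 / 2) {L : ℕ}
    (hℓ0 : 0 ≤ ℓ) (hℓr : ℓ ≤ r / 32) (hℓ : 32 * L * ℓ ≤ r) :
    uniformPoints n {X | (disp (X i) (X j) ≠ 0 ∧
        ∀ s < L, ∃ k ∈ A, edgeChart X i j (X k) ∈ sector r L s) ∧
        ∀ l ∈ B, ∀ s < L, ∀ k ∈ A, edgeChart X i j (X k) ∈ sector r L s →
          edgeChart X i j (X l) ∉ cell r ℓ (edgeChart X i j (X k))}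
      ≤ ENNReal.ofReal (Real.exp (-(B.card * (L * ℓ * r / 8)))) := by
  have hkB : ∀ k ∈ A, k ∉ B := fun k hk => Finset.disjoint_left.1 hAB hk
  have key := uniformPoints_confined_le B (fun X => disp (X i) (X j) ≠ 0 ∧
      ∀ s < L, ∃ k ∈ A, edgeChart X i j (X k) ∈ sector r L s)
    (fun X z => ∀ s < L, ∀ k ∈ A, edgeChart X i j (X k) ∈ sector r L s →
          edgeChart X i j z ∉ cell r ℓ (edgeChart X i j (X k))) ?_ ?_ ?_ ?_
    (c := ENNReal.ofReal (Real.exp (-(L * ℓ * r / 8)))) ?_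
  · refine key.trans (le_of_eq ?_)
    rw [← ENNReal.ofReal_pow (Real.exp_nonneg _), ← Real.exp_nat_mul]
    congr 2; ring
  · have : {X : Fin n → Torus | disp (X i) (X j) ≠ 0 ∧
        ∀ s < L, ∃ k ∈ A, edgeChart X i j (X k) ∈ sector r L s} =
        {X | disp (X i) (X j) ≠ 0} ∩
        ⋂ s ∈ Finset.range L, ⋃ k ∈ A, {X | edgeChart X i j (X k) ∈ sector r L s} := by
      ext X; simp
    rw [this]
    exact (measurableSet_disp_ne i j).inter (Finset.measurableSet_biInter _ fun s _ =>
      Finset.measurableSet_biUnion _ fun k _ =>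
        (measurable_edgeChart_apply i j k) (measurableSet_strip _ _ _ _))
  · have : {p : (Fin n → Torus) × Torus | ∀ s < L, ∀ k ∈ A, edgeChart p.1 i j (p.1 k) ∈ sector r L s →
          edgeChart p.1 i j p.2 ∉ cell r ℓ (edgeChart p.1 i j (p.1 k))} =
        ⋂ s ∈ Finset.range L, ⋂ k ∈ A, {p | edgeChart p.1 i j (p.1 k) ∈ sector r L s}ᶜ ∪
          {p | edgeChart p.1 i j p.2 ∈ cell r ℓ (edgeChart p.1 i j (p.1 k))}ᶜ := by
      ext p; simp [imp_iff_not_or]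
    rw [this]
    have hk : ∀ k, Measurable fun p : (Fin n → Torus) × Torus => edgeChart p.1 i j (p.1 k) :=
      fun k => (measurable_edgeChart_apply i j k).comp measurable_fst
    exact Finset.measurableSet_biInter _ fun s _ => Finset.measurableSet_biInter _ fun k _ =>
      ((hk k) (measurableSet_strip _ _ _ _)).compl.union
        (((hk k).prodMk (measurable_edgeChart i j)) (measurableSet_cell r ℓ)).compl
  · intro X Y h hX
    rw [← h i hiB, ← h j hjB, ← edgeChart_congr (h i hiB) (h j hjB)]
    refine ⟨hX.1, fun s hs => ?_⟩
    obtain ⟨k, hk, hks⟩ := hX.2 s hs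
    exact ⟨k, hk, by rwa [← h k (hkB k hk)]⟩
  · intro X Y h z hz s hs k hk
    rw [← edgeChart_congr (h i hiB) (h j hjB), ← h k (hkB k hk)]
    exact hz s hs k hk
  · rintro X ⟨hX, hsec⟩
    have : Nonempty (Fin n) := ⟨i⟩
    choose! f hfA hfs using hsec
    set S : Set Torus := ⋃ s ∈ Finset.range L,
      {z | edgeChart X i j z ∈ cell r ℓ (edgeChart X i j (X (f s)))} with hS
    have hm : ∀ s, MeasurableSet {z | edgeChart X i j z ∈ cell r ℓ (edgeChart X i j (X (f s)))} :=
      fun s => ((measurable_edgeChart i j).comp (measurable_const.prodMk measurable_id))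
        (measurableSet_strip _ _ _ _)
    refine (measure_mono (t := Sᶜ) ?_).trans (volume_compl_le_exp
      (Finset.measurableSet_biUnion _ fun s _ => hm s) ?_)
    · intro z hz hzS
      simp only [hS, Set.mem_iUnion] at hzS
      obtain ⟨s, hs, hzs⟩ := hzS
      have hs' := Finset.mem_range.1 hs
      exact hz s hs' (f s) (hfA s hs') (hfs s hs') hzs
    · rw [measure_biUnion_finset ?_ fun s _ => hm s]
      · have hvol : ∀ s ∈ Finset.range L,
            volume {z | edgeChart X i j z ∈ cell r ℓ (edgeChart X i j (X (f s)))}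
              = ENNReal.ofReal (ℓ * r / 8) := by
          intro s hs
          have hs' := Finset.mem_range.1 hs
          have := volume_chart_preimage (unit_sq hX) (X i) (measurableSet_strip _ _ _ _)
            fun p hp => sq_add_sq_lt_of_mem_cell hr hr' hℓr hs' (hfs s hs') hp
          rw [volume_strip _ _ _ hℓ0] at this
          refine this.trans ?_
          congr 1; ring
        rw [Finset.sum_congr rfl hvol, Finset.sum_const, Finset.card_range, nsmul_eq_mul,
          ← ENNReal.ofReal_natCast, ← ENNReal.ofReal_mul (Nat.cast_nonneg _)]
        exact le_of_eq (by congr 1; ring)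
      · intro s hs s' hs' hss
        have h1 := Finset.mem_range.1 hs
        have h2 := Finset.mem_range.1 hs'
        exact (disjoint_cell hr hℓ hss h1 h2 (hfs s h1) (hfs s' h2)).preimage _

theorem uniformPoints_free_long_edge_le {n m : ℕ} (hmn : 2 * m + 2 ≤ n) {i j : Fin n} (hij : i ≠ j)
    {r ℓ : ℝ} (hr : 0 < r) (hr' : r ≤ 1 / 2) {L : ℕ} (hℓ0 : 0 < ℓ) (hℓr : ℓ ≤ r / 32)
    (hℓ : 32 * L * ℓ ≤ r) :
    uniformPoints n {X | ℓ < flatDist (X i) (X j) ∧ IsFreeEdge X r i j} ≤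
      ENNReal.ofReal (L * Real.exp (-(m * (r ^ 2 / (256 * L)))) +
        Real.exp (-(m * (L * ℓ * r / 8)))) := by
  classical
  -- The two ends of the edge are set aside; the rest supplies disjoint `A` and `B` of size m.
  have hc : 2 * m ≤ (Finset.univ \ {i, j} : Finset (Fin n)).card := by
    rw [Finset.card_sdiff_of_subset (Finset.subset_univ _), Finset.card_pair hij, Finset.card_univ,
      Fintype.card_fin]
    omega
  obtain ⟨A, hAs, hAc⟩ := Finset.exists_subset_card_eq
    (show m ≤ (Finset.univ \ {i, j} : Finset (Fin n)).card by omega)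
  have hc' : m ≤ ((Finset.univ \ {i, j} : Finset (Fin n)) \ A).card := by
    rw [Finset.card_sdiff_of_subset hAs]; omega
  obtain ⟨B, hBs, hBc⟩ := Finset.exists_subset_card_eq hc'
  have hA : ∀ k ∈ A, k ≠ i ∧ k ≠ j := fun k hk => by simpa using hAs hk
  have hB : ∀ k ∈ B, (k ≠ i ∧ k ≠ j) ∧ k ∉ A := fun k hk => by simpa using hBs hk
  have hAB : Disjoint A B := Finset.disjoint_right.2 fun k hk => (hB k hk).2
  have h1 := uniformPoints_sector_empty_le (n := n) (i := i) (j := j) (A := A)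
    (fun h => (hA _ h).1 rfl) (fun h => (hA _ h).2 rfl) hr hr' L
  have h2 := uniformPoints_no_crossing_le (n := n) (i := i) (j := j) (A := A) (B := B)
    (fun h => (hB _ h).1.1 rfl) (fun h => (hB _ h).1.2 rfl) hAB hr hr' hℓ0.le hℓr hℓ
  rw [hAc] at h1
  rw [hBc] at h2
  refine uniformPoints_or_le (by positivity) (by positivity) h1 h2 ?_
  rintro X ⟨hlong, hfree⟩
  have hd : disp (X i) (X j) ≠ 0 := by
    intro h
    rw [flatDist_eq_disp, h] at hlong
    simp at hlong
    linarith
  by_cases hsec : ∀ s < L, ∃ k ∈ A, edgeChart X i j (X k) ∈ sector r L s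
  · refine Or.inr ⟨⟨hd, hsec⟩, fun l hl s hs k hk hks hcell => ?_⟩
    obtain ⟨hα, -, -, hαβ⟩ := slope_of_mem_sector hr hs hks
    obtain ⟨h3, h4⟩ := edges_cross hr hr' hℓ0 hℓr hlong.le rfl hks.1 hα hαβ hcell
    refine h4 (hfree.2 k l ⟨?_, h3⟩ ?_)
    · rintro rfl; exact (hB _ hl).2 hk
    · intro h
      rw [Sym2.eq_iff] at h
      rcases h with h | h
      · exact (hA k hk).1 h.1
      · exact (hA k hk).2 h.1
  · push Not at hsec
    exact Or.inl ⟨hd, hsec⟩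

/-- Edges of length at most `ℓ` offer too small a target for crossings, so they are excluded by the
expected number of edges at radius `ℓ`. -/
theorem uniformPoints_exists_free_edge_le {n m : ℕ} (hmn : 2 * m + 2 ≤ n)
    {r ℓ : ℝ} (hr : 0 < r) (hr' : r ≤ 1 / 2) {L : ℕ} (hℓ0 : 0 < ℓ) (hℓr : ℓ ≤ r / 32)
    (hℓ : 32 * L * ℓ ≤ r) :
    uniformPoints n {X | ∃ i j, IsFreeEdge X r i j} ≤
      ENNReal.ofReal ((n : ℝ) ^ 2 * (4 * ℓ ^ 2) + (n : ℝ) ^ 2 *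
        (L * Real.exp (-(m * (r ^ 2 / (256 * L)))) + Real.exp (-(m * (L * ℓ * r / 8))))) := by
  have h := uniformPoints_exists_le (n := n) (Finset.univ : Finset (Fin n × Fin n))
    (fun q X => q.1 ≠ q.2 ∧ ℓ < flatDist (X q.1) (X q.2) ∧ IsFreeEdge X r q.1 q.2)
    (c := L * Real.exp (-(m * (r ^ 2 / (256 * L)))) + Real.exp (-(m * (L * ℓ * r / 8)))) ?_
  · rw [show ((Finset.univ : Finset (Fin n × Fin n)).card : ℝ) = (n : ℝ) ^ 2 by
      simp [sq]] at h
    refine uniformPoints_or_le (by positivity) (by positivity) (uniformPoints_adj_le n hℓ0.le) h ?_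
    rintro X ⟨i, j, hfree⟩
    rcases le_or_gt (flatDist (X i) (X j)) ℓ with hle | hlt
    · exact Or.inl ⟨i, j, hfree.1.1, hle⟩
    · exact Or.inr ⟨(i, j), Finset.mem_univ _, hfree.1.1, hlt, hfree⟩
  · rintro ⟨i, j⟩ -
    by_cases hij : i = j
    · simp [hij]
    · simpa [hij] using uniformPoints_free_long_edge_le hmn hij hr hr' hℓ0 hℓr hℓ

theorem tendsto_pow_mul_exp_neg_mul (k : ℕ) {b : ℝ} (hb : 0 < b) :
    Tendsto (fun x : ℝ => x ^ k * Real.exp (-b * x)) atTop (𝓝 0) := by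
  simpa using tendsto_rpow_mul_exp_neg_mul_atTop_nhds_zero k b hb

/-- The bound of `uniformPoints_exists_free_edge_le` for `n = y ^ 48` points, in terms of `y`. -/
theorem free_edge_bound_le {n m L : ℕ} {r y : ℝ} (hy : 2 ≤ y) (hn : (n : ℝ) = y ^ 48)
    (hm : (n : ℝ) / 8 ≤ m) (hL : y ^ 16 ≤ L) (hL' : L ≤ 2 * y ^ 16) (hr : 1 ≤ r * y ^ 12) :
    (n : ℝ) ^ 2 * (4 * ((y ^ 49)⁻¹) ^ 2) + (n : ℝ) ^ 2 *
        (L * Real.exp (-(m * (r ^ 2 / (256 * L)))) + Real.exp (-(m * (L * (y ^ 49)⁻¹ * r / 8))))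
      ≤ 4 * (y ^ 2)⁻¹ + (2 * (y ^ 112 * Real.exp (-(1 / 4096) * y)) +
        y ^ 96 * Real.exp (-(1 / 4096) * y)) := by
  have hy0 : 0 < y := by linarith
  have hL0 : (0 : ℝ) < L := lt_of_lt_of_le (by positivity) hL
  have hr0 : 0 < r := by
    by_contra h
    have := mul_nonneg (neg_nonneg.2 (not_lt.1 h)) (pow_nonneg hy0.le 12)
    linarith
  rw [hn] at hm ⊢
  have h1 : (y ^ 48) ^ 2 * (4 * ((y ^ 49)⁻¹) ^ 2) = 4 * (y ^ 2)⁻¹ := by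
    field_simp
  -- Up to constants the exponent is at least y^(48 - 24 - 16) = y^8.
  have h2 : y / 4096 ≤ m * (r ^ 2 / (256 * L)) := by
    have ha : 1 ≤ r ^ 2 * y ^ 24 := by
      calc (1 : ℝ) ≤ (r * y ^ 12) ^ 2 := one_le_pow₀ hr
        _ = _ := by ring
    rw [mul_div_assoc', le_div_iff₀ (by positivity)]
    have hb : y ^ 48 / 8 * r ^ 2 ≤ m * r ^ 2 := mul_le_mul_of_nonneg_right hm (sq_nonneg r)
    have hc : y ^ 24 ≤ y ^ 48 * r ^ 2 := by
      have := mul_le_mul_of_nonneg_left ha (pow_nonneg hy0.le 24)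
      calc y ^ 24 = y ^ 24 * 1 := by ring
        _ ≤ y ^ 24 * (r ^ 2 * y ^ 24) := this
        _ = _ := by ring
    have hd : y ^ 17 ≤ y ^ 24 := pow_le_pow_right₀ (by linarith) (by norm_num)
    have he : y * L ≤ 2 * y ^ 17 := by
      calc y * L ≤ y * (2 * y ^ 16) := mul_le_mul_of_nonneg_left hL' hy0.le
        _ = _ := by ring
    nlinarith
  -- Up to constants the exponent is at least y^(48 + 16 - 49 - 12) = y^3.
  have h3 : y / 4096 ≤ m * (L * (y ^ 49)⁻¹ * r / 8) := by
    have ha : y ^ 48 / 8 * (y ^ 16 * (y ^ 49)⁻¹ * r / 8) ≤ m * (L * (y ^ 49)⁻¹ * r / 8) := by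
      gcongr
    have hb : y ^ 48 / 8 * (y ^ 16 * (y ^ 49)⁻¹ * r / 8) = y ^ 3 * (r * y ^ 12) / 64 := by
      field_simp
      ring
    have hc : y ^ 3 * 1 ≤ y ^ 3 * (r * y ^ 12) := mul_le_mul_of_nonneg_left hr (by positivity)
    have hd : y ^ 1 ≤ y ^ 3 := pow_le_pow_right₀ (by linarith) (by norm_num)
    linarith
  have h4 : Real.exp (-(m * (r ^ 2 / (256 * L)))) ≤ Real.exp (-(1 / 4096) * y) :=
    Real.exp_le_exp.2 (by linarith)
  have h5 : Real.exp (-(m * (L * (y ^ 49)⁻¹ * r / 8))) ≤ Real.exp (-(1 / 4096) * y) :=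
    Real.exp_le_exp.2 (by linarith)
  rw [h1]
  have h6 : (L : ℝ) * Real.exp (-(m * (r ^ 2 / (256 * L)))) ≤
      2 * y ^ 16 * Real.exp (-(1 / 4096) * y) := by gcongr
  have h7 := mul_le_mul_of_nonneg_left (add_le_add h6 h5) (show 0 ≤ (y ^ 48) ^ 2 by positivity)
  refine add_le_add le_rfl (h7.trans (le_of_eq ?_))
  ring

/-- Bounding the logarithm below by 1 leaves r ≥ n^(-1/4). With y = n^(1/48), the choices L ≈ y^16 =
n^(1/3) and ℓ = y^(-49), slightly below 1/n, make nℓ → 0 while both exponents still grow like a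
power of n. -/
theorem whp_no_free_edge {r : ℕ → ℝ} (hpos : ∀ n, 0 < r n) (hzero : Tendsto r atTop (𝓝 0))
    (h : (fun n : ℕ => Real.log (n : ℝ) ^ (3 / 4 : ℝ) / (n : ℝ) ^ (1 / 4 : ℝ)) =o[atTop] r) :
    WHP fun n X => ¬ ∃ i j, IsFreeEdge X (r n) i j := by
  have hy : Tendsto (fun n : ℕ => (n : ℝ) ^ (1 / 48 : ℝ)) atTop atTop :=
    (tendsto_rpow_atTop (by norm_num)).comp tendsto_natCast_atTop_atTop
  have hb1 : Tendsto (fun y : ℝ => (y ^ 2)⁻¹) atTop (𝓝 0) :=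
    tendsto_inv_atTop_zero.comp (tendsto_pow_atTop two_ne_zero)
  have hb := (hb1.const_mul 4).add (((tendsto_pow_mul_exp_neg_mul 112
    (show (0 : ℝ) < 1 / 4096 by norm_num)).const_mul 2).add
    (tendsto_pow_mul_exp_neg_mul 96 (show (0 : ℝ) < 1 / 4096 by norm_num)))
  rw [show (4 * 0 + (2 * 0 + 0) : ℝ) = 0 by norm_num] at hb
  refine WHP_of_bad (hb.comp hy) ?_
  have hlog : ∀ᶠ n : ℕ in atTop, 1 ≤ Real.log (n : ℝ) :=
    (Real.tendsto_log_atTop.comp tendsto_natCast_atTop_atTop).eventually_ge_atTop 1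
  filter_upwards [eventually_ge_atTop 4, hy.eventually_ge_atTop 2, hlog, h.bound one_pos,
    hzero.eventually (gt_mem_nhds (show (0 : ℝ) < 1 / 2 by norm_num))] with n hn hy2 hlog hbd hr2
  have hr0 := hpos n
  have hn0 : (0 : ℝ) < n := by exact_mod_cast (show 0 < n by omega)
  set y := (n : ℝ) ^ (1 / 48 : ℝ) with hydef
  have hy0 : 0 < y := by linarith
  have hny : (n : ℝ) = y ^ 48 := by
    rw [hydef, ← Real.rpow_natCast, ← Real.rpow_mul hn0.le]
    norm_num
  have hr : 1 ≤ r n * y ^ 12 := by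
    have hy12 : (n : ℝ) ^ (1 / 4 : ℝ) = y ^ 12 := by
      rw [hydef, ← Real.rpow_natCast, ← Real.rpow_mul hn0.le]
      norm_num
    have h1 : 1 ≤ Real.log (n : ℝ) ^ (3 / 4 : ℝ) := Real.one_le_rpow hlog (by norm_num)
    rw [hy12, one_mul, Real.norm_of_nonneg (by positivity), Real.norm_of_nonneg hr0.le,
      div_le_iff₀ (by positivity)] at hbd
    linarith
  have hL := Nat.le_ceil (y ^ 16)
  have hL' : (⌈y ^ 16⌉₊ : ℝ) ≤ 2 * y ^ 16 := by
    have h1 := Nat.ceil_lt_add_one (show 0 ≤ y ^ 16 by positivity)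
    have h2 : 1 ≤ y ^ 16 := one_le_pow₀ (by linarith)
    linarith
  have hm : (n : ℝ) / 8 ≤ (((n - 2) / 2 : ℕ) : ℝ) := by
    have : n ≤ 8 * ((n - 2) / 2) := by omega
    have : (n : ℝ) ≤ 8 * (((n - 2) / 2 : ℕ) : ℝ) := by exact_mod_cast this
    linarith
  -- As `⌈y ^ 16⌉₊ ≤ 2 * y ^ 16`, this one inequality yields both constraints on `ℓ`: `ℓ ≤ r / 32`
  -- and `32 * L * ℓ ≤ r`.
  have hℓ : 64 * y ^ 16 * (y ^ 49)⁻¹ ≤ r n := by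
    have h1 : 64 * y ^ 16 * (y ^ 49)⁻¹ * y ^ 12 = 64 * (y ^ 21)⁻¹ := by
      field_simp
    have h2 : 64 * (y ^ 21)⁻¹ ≤ 1 := by
      rw [← div_eq_mul_inv, div_le_one (by positivity)]
      calc (64 : ℝ) ≤ 2 ^ 21 := by norm_num
        _ ≤ y ^ 21 := pow_le_pow_left₀ (by norm_num) hy2 21
    refine le_of_mul_le_mul_right ?_ (show 0 < y ^ 12 by positivity)
    linarith
  have hi0 : 0 < (y ^ 49)⁻¹ := by positivity
  have key := uniformPoints_exists_free_edge_le (n := n) (m := (n - 2) / 2) (by omega) hr0 hr2.le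
    (L := ⌈y ^ 16⌉₊) hi0 ?_ ?_
  · refine (measure_mono ?_).trans (key.trans (ENNReal.ofReal_le_ofReal
      (free_edge_bound_le hy2 hny hm hL hL' hr)))
    intro X hX
    exact not_not.1 hX
  · have h1 : 1 ≤ y ^ 16 := one_le_pow₀ (by linarith)
    nlinarith
  · nlinarith

end TorusRGG

theorem theorem5 (r : ℕ → ℝ) (hpos : ∀ n, 0 < r n) (hzero : Tendsto r atTop (𝓝 0)) :
    (r =o[atTop] (fun n : ℕ => 1 / (n : ℝ)) →
      TorusRGG.WHP fun n X => ∀ i j, ¬ (TorusRGG.diskGraph X (r n)).Adj i j) ∧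
    ((fun n : ℕ => 1 / (n : ℝ)) =o[atTop] r →
      r =o[atTop] (fun n : ℕ => 1 / (n : ℝ) ^ (2 / 3 : ℝ)) →
      TorusRGG.WHP fun n X =>
        (∃ i j, (TorusRGG.diskGraph X (r n)).Adj i j) ∧
        ∀ i j, (TorusRGG.diskGraph X (r n)).Adj i j → TorusRGG.IsFreeEdge X (r n) i j) ∧
    (∀ ε : ℝ, 0 < ε →
      (fun n : ℕ => 1 / (n : ℝ) ^ (2 / 3 : ℝ)) =o[atTop] r →
      r =o[atTop] (fun n : ℕ => 1 / (n : ℝ) ^ (1 / 2 + ε : ℝ)) →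
      TorusRGG.WHP fun n X => ∃ i j, TorusRGG.IsFreeEdge X (r n) i j) ∧
    ((fun n : ℕ => Real.log (n : ℝ) ^ (3 / 4 : ℝ) / (n : ℝ) ^ (1 / 4 : ℝ)) =o[atTop] r →
      TorusRGG.WHP fun n X => ¬ ∃ i j, TorusRGG.IsFreeEdge X (r n) i j) :=
  ⟨TorusRGG.whp_no_edge hpos, TorusRGG.whp_edges_all_free hpos hzero,
    fun _ hε => TorusRGG.whp_exists_free_edge hpos hzero hε, TorusRGG.whp_no_free_edge hpos hzero⟩
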